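/- Let $\ell\ge 1$ be an integer, $n=2\ell$, and work over $\mathbb C$. For a $2\times n$ matrix $A$ and an $\ell\times n$ matrix $B$ with columns $A_c$, $B_c$, let $\mathrm{Seg}_{2,\ell}(A,B)$ be the determinant of the $n\times n$ matrix with columns $A_c\otimes B_c$. Let $\mathrm{Gr}(2,n)^\circ\subset \mathrm{Gr}(2,n)$ be the set of points all of whose Plücker coordinates are nonzero, and let $$\pi:\mathrm{Gr}(2,n)^\circ\to\mathbb P H^0(\mathrm{Gr}(\ell,n),\mathcal O(2)),\qquad A\mapsto \mathrm{Seg}_{2,\ell}(A,B),$$ where $\mathrm{Seg}_{2,\ell}(A,B)$ is regarded as a polynomial in $B$, up to scaling. The Segre coefficient variety $\mathrm{Coeff}(\mathrm{Seg}_{2,\ell})$ is the Zariski closure of the image of $\pi$, with its reduced structure. Let $$(\mathbb P^1)^{2\ell}/\!/\mathrm{SL}_2=\mathrm{Proj}\,\bigoplus_{d\ge 0}H^0\big((\mathbb P^1)^{2\ell},\mathcal O(d,\dots,d)\big)^{\mathrm{SL}_2}$$ be the GIT quotient with respect to the linearization $(1,\dots,1)$. Then: 1. $\mathrm{Coeff}(\mathrm{Seg}_{2,\ell})$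 is isomorphic to $(\mathbb P^1)^{2\ell}/\!/\mathrm{SL}_2$ as a scheme over $\mathbb C$. 2. The Segre determinant determines generic torus orbit closures in $\mathrm{Gr}(2,2\ell)$: for $A,A'\in\mathrm{Gr}(2,2\ell)^\circ$ one has $\pi(A)=\pi(A')$ if and only if the Zariski closures in $\mathrm{Gr}(2,2\ell)$ of the orbits of $A$ and $A'$ under the torus $(\mathbb C^*)^{2\ell}$ coincide. -/

import Mathlib

open MvPolynomial DirectSum CategoryTheory AlgebraicGeometry
open scoped LinearAlgebra.Projectivization

noncomputable section

namespace SegreCoeff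

/-! ## The Segre determinant -/

/-- The Segre matrix of `A` and `B`: its `c`-th column is `A_c ⊗ B_c`, where `A_c` and `B_c` are the
`c`-th columns; the rows are the pairs `(i, j)` in lexicographic order. -/
def segreMatrix {R : Type*} [CommRing R] {k ℓ : ℕ} (A : Matrix (Fin k) (Fin (k * ℓ)) R)
    (B : Matrix (Fin ℓ) (Fin (k * ℓ)) R) : Matrix (Fin (k * ℓ)) (Fin (k * ℓ)) R :=
  Matrix.of fun r c => A (finProdFinEquiv.symm r).1 c * B (finProdFinEquiv.symm r).2 c

/-- The Segre determinant. -/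
def segreDet {R : Type*} [CommRing R] {k ℓ : ℕ} (A : Matrix (Fin k) (Fin (k * ℓ)) R)
    (B : Matrix (Fin ℓ) (Fin (k * ℓ)) R) : R :=
  (segreMatrix A B).det

/-- `Seg(A, B)` for a fixed complex matrix `A`, as a polynomial in the entries `b_{ij}` of the
generic matrix `B`. -/
def segreForm {k ℓ : ℕ} (A : Matrix (Fin k) (Fin (k * ℓ)) ℂ) :
    MvPolynomial (Fin ℓ × Fin (k * ℓ)) ℂ :=
  segreDet (A.map C) (Matrix.of fun i j => X (i, j))

/-! ## Grassmannians -/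

/-- The complex points of the Grassmannian `Gr(k, n)`: the `k`-dimensional subspaces of `ℂⁿ`. -/
def Gr (k n : ℕ) : Type := {W : Submodule ℂ (Fin n → ℂ) // Module.finrank ℂ W = k}

/-- A `k × n` matrix whose rows are a basis of `W`. Another choice of basis multiplies all
Plücker coordinates of `W`, and the Segre determinant, by a nonzero constant. -/
def Gr.matrix {k n : ℕ} (W : Gr k n) : Matrix (Fin k) (Fin n) ℂ :=
  Matrix.of fun i => (Module.finBasisOfFinrankEq ℂ W.1 W.2 i : Fin n → ℂ)

/-- Plücker coordinates: the `k × k` minors, indexed by the `k`-subsets of the columns. -/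
def Gr.plucker {k n : ℕ} (W : Gr k n) (I : Fin k ↪o Fin n) : ℂ :=
  (W.matrix.submatrix id I).det

/-- The matroid of `W` is uniform: all Plücker coordinates are nonzero. -/
def Gr.IsUniform {k n : ℕ} (W : Gr k n) : Prop :=
  ∀ I : Fin k ↪o Fin n, W.plucker I ≠ 0

/-- The torus `(ℂˣ)ⁿ` acts on `Gr(k, n)` by rescaling the coordinates of `ℂⁿ`. -/
def Gr.torusAct {k n : ℕ} (t : Fin n → ℂˣ) (W : Gr k n) : Gr k n :=
  ⟨W.1.map (LinearEquiv.piCongrRight fun j => LinearEquiv.smulOfUnit (t j) :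
      (Fin n → ℂ) ≃ₗ[ℂ] (Fin n → ℂ)).toLinearMap, by
    rw [LinearEquiv.finrank_map_eq]; exact W.2⟩

/-- The Zariski closure in `Gr(k, n)` of the torus orbit of `W`. The Zariski closed subsets of
`Gr(k, n)` are the zero loci of homogeneous polynomials in the Plücker coordinates. -/
def Gr.orbitClosure {k n : ℕ} (W : Gr k n) : Set (Gr k n) :=
  {U | ∀ (d : ℕ) (F : MvPolynomial (Fin k ↪o Fin n) ℂ), F.IsHomogeneous d →
    (∀ t : Fin n → ℂˣ, eval (W.torusAct t).plucker F = 0) → eval U.plucker F = 0}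

/-! ## Linear substitutions and sections of line bundles -/

/-- The substitution `f(B) ↦ f(g B)` on polynomials in the entries of a generic `m × n`
matrix `B`. -/
def leftSubst {m : ℕ} (n : ℕ) (g : Matrix (Fin m) (Fin m) ℂ) :
    MvPolynomial (Fin m × Fin n) ℂ →ₐ[ℂ] MvPolynomial (Fin m × Fin n) ℂ :=
  aeval fun p => ∑ i, C (g p.1 i) * X (i, p.2)

/-- The space `H⁰(Gr(m, n), 𝒪(d))` in Stiefel coordinates: the polynomials `f` in the entries of
an `m × n` matrix `B` (whose row space is the point of the Grassmannian) with
`f(g B) = det(g)ᵈ f(B)` for all `g ∈ GL_m`. -/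
def grSections (m n d : ℕ) : Submodule ℂ (MvPolynomial (Fin m × Fin n) ℂ) where
  carrier := {f | ∀ g : GL (Fin m) ℂ, leftSubst n g.1 f = g.1.det ^ d • f}
  zero_mem' := fun g => by simp
  add_mem' := fun {f f'} hf hf' g => by
    rw [map_add, hf g, hf' g, smul_add]
  smul_mem' := fun c f hf g => by
    rw [map_smul, hf g, smul_comm]

lemma segreForm_mem {k ℓ : ℕ} (A : Matrix (Fin k) (Fin (k * ℓ)) ℂ) :
    segreForm A ∈ grSections ℓ (k * ℓ) k := by
  intro g
  have hdet : leftSubst (k * ℓ) g.1 (segreForm A) =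
      (((Matrix.kronecker (1 : Matrix (Fin k) (Fin k) (MvPolynomial (Fin ℓ × Fin (k * ℓ)) ℂ))
        (g.1.map C)).submatrix finProdFinEquiv.symm finProdFinEquiv.symm) *
        segreMatrix (A.map C) (Matrix.of fun i j => X (i, j))).det := by
    rw [segreForm, segreDet, AlgHom.map_det]
    congr 1
    ext1 r c
    rw [Matrix.mul_apply, ← finProdFinEquiv.sum_comp, Fintype.sum_prod_type]
    simp only [segreMatrix, leftSubst, Matrix.of_apply, AlgHom.mapMatrix_apply, Matrix.map_apply,
      map_mul, aeval_X, Matrix.submatrix_apply, Matrix.kronecker, Matrix.kroneckerMap_apply,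
      Matrix.one_apply, Equiv.symm_apply_apply, ite_mul, one_mul, zero_mul,
      Finset.sum_ite_irrel, Finset.sum_const_zero, Finset.sum_ite_eq, Finset.mem_univ, if_true,
      Finset.mul_sum, algHom_C, algebraMap_eq]
    exact Finset.sum_congr rfl fun x _ => by ring
  rw [hdet, Matrix.det_mul, Matrix.det_submatrix_equiv_self, Matrix.kronecker,
    Matrix.det_kronecker]
  rw [← RingHom.mapMatrix_apply, ← RingHom.map_det]
  simp [segreForm, segreDet, smul_eq_C_mul]

/-- `H⁰(Gr(m, n), 𝒪(d))` is finite-dimensional. -/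
lemma grSections_finite (m n d : ℕ) : FiniteDimensional ℂ (grSections m n d) := by
  have hc : ∀ (f : MvPolynomial (Fin m × Fin n) ℂ) (s : Fin m × Fin n →₀ ℕ),
      coeff s (leftSubst n (Matrix.scalar (Fin m) (2 : ℂ)) f) = 2 ^ s.degree * coeff s f := by
    intro f s
    induction f using MvPolynomial.induction_on' with
    | monomial u a =>
      have h1 : leftSubst n (Matrix.scalar (Fin m) (2 : ℂ)) (monomial u a)
          = monomial u (2 ^ u.degree * a) := by
        rw [leftSubst, aeval_monomial, monomial_eq (s := u) (a := 2 ^ u.degree * a), algebraMap_eq]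
        simp only [Matrix.scalar_apply, Matrix.diagonal_apply, apply_ite C, map_zero, ite_mul,
          zero_mul, Finset.sum_ite_eq, Finset.mem_univ, if_true, mul_pow, Finsupp.prod_mul,
          C_mul, C_pow]
        have h2 : (u.prod fun _ b => (C (2 : ℂ) : MvPolynomial (Fin m × Fin n) ℂ) ^ b)
            = C 2 ^ u.degree := by
          rw [Finsupp.prod, Finset.prod_pow_eq_pow_sum]; rfl
        rw [h2]; ring
      rw [h1, coeff_monomial, coeff_monomial]
      split_ifs with h
      · rw [h]
      · simp
    | add p q hp hq => rw [map_add, coeff_add, coeff_add, hp, hq, mul_add]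
  have key : grSections m n d ≤ restrictTotalDegree (Fin m × Fin n) ℂ (m * d) := by
    intro f hf
    rw [mem_restrictTotalDegree]
    refine Finset.sup_le fun s hs => ?_
    have h2 : IsUnit (Matrix.scalar (Fin m) (2 : ℂ)).det := by
      simp
    have h := congrArg (coeff s) (hf (Matrix.GeneralLinearGroup.mk'' _ h2))
    rw [show (Matrix.GeneralLinearGroup.mk'' _ h2).1 = Matrix.scalar (Fin m) (2 : ℂ) from rfl,
      hc, coeff_smul, smul_eq_mul] at h
    have h3 := mul_right_cancel₀ (mem_support_iff.mp hs) h
    have h4 : (Matrix.scalar (Fin m) (2 : ℂ)).det ^ d = 2 ^ (m * d) := by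
      simp [pow_mul]
    rw [h4] at h3
    have h5 : s.degree = m * d := Nat.pow_right_injective le_rfl (by
      have : ((2 ^ s.degree : ℕ) : ℂ) = ((2 ^ (m * d) : ℕ) : ℂ) := by push_cast; exact h3
      exact_mod_cast this)
    exact h5.le
  exact Submodule.finiteDimensional_of_le key

/-- The Segre form of a matrix with nonzero maximal minors is nonzero. -/
lemma segreForm_ne_zero {k ℓ : ℕ} (A : Matrix (Fin k) (Fin (k * ℓ)) ℂ)
    (hA : ∀ I : Fin k ↪o Fin (k * ℓ), (A.submatrix id I).det ≠ 0) : segreForm A ≠ 0 := by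
  intro h
  let B : Matrix (Fin ℓ) (Fin (k * ℓ)) ℂ :=
    Matrix.of fun j c => if (finProdFinEquiv.symm c).2 = j then 1 else 0
  have h1 : eval (fun p : Fin ℓ × Fin (k * ℓ) => B p.1 p.2) (segreForm A) = segreDet A B := by
    rw [segreForm, segreDet, RingHom.map_det, segreDet]
    congr 1
    ext1 r c
    simp [segreMatrix]
  let I : Fin ℓ → (Fin k ↪o Fin (k * ℓ)) := fun j =>
    OrderEmbedding.ofStrictMono (fun i => finProdFinEquiv (i, j)) (by
      intro a b hab
      have hl : 0 < ℓ := j.pos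
      have hab' : a.1 < b.1 := hab
      change (finProdFinEquiv (a, j)).1 < (finProdFinEquiv (b, j)).1
      simp only [finProdFinEquiv_apply_val]
      have := Nat.mul_lt_mul_of_pos_left hab' hl
      omega)
  have h2 : segreDet A B = ∏ j, (A.submatrix id (I j)).det := by
    rw [← Matrix.det_blockDiagonal, segreDet,
      ← Matrix.det_submatrix_equiv_self finProdFinEquiv (segreMatrix A B)]
    congr 1
    ext ⟨i, j⟩ ⟨i', j'⟩
    simp only [segreMatrix, B, Matrix.submatrix_apply, Matrix.of_apply,
      Equiv.symm_apply_apply, Matrix.blockDiagonal_apply, id, eq_comm (a := j)]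
    by_cases hj : j' = j
    · subst hj; simp only [if_true, mul_one]; rfl
    · simp [hj]
  rw [h, map_zero, h2] at h1
  exact (Finset.prod_ne_zero_iff.mpr fun j _ => hA (I j)) h1.symm

/-- The Segre coefficient map `π : Gr(k, kℓ)° → ℙ H⁰(Gr(ℓ, kℓ), 𝒪(k))`, `A ↦ Seg(A, B)`. -/
def segreMap {k ℓ : ℕ} (W : Gr k (k * ℓ)) (hW : W.IsUniform) :
    ℙ ℂ (grSections ℓ (k * ℓ) k) :=
  Projectivization.mk ℂ ⟨segreForm W.matrix, segreForm_mem W.matrix⟩ fun h =>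
    segreForm_ne_zero W.matrix hW (congrArg Subtype.val h)

/-! ## `Proj` over `ℂ` and projective varieties -/

/-- `Proj` of a graded `ℂ`-algebra, as a scheme over `Spec ℂ`. -/
def projOver {A : Type} [CommRing A] [Algebra ℂ A] (𝒜 : ℕ → Submodule ℂ A) [GradedAlgebra 𝒜] :
    Over (Spec (CommRingCat.of ℂ)) :=
  Over.mk (Proj.toSpecZero 𝒜 ≫ Spec.map (CommRingCat.ofHom (algebraMap ℂ (𝒜 0))))

/-- The Zariski closure of a subset of `ℙ^{N-1}`. -/
def zariskiClosure {N : ℕ} (S : Set (ℙ ℂ (Fin N → ℂ))) : Set (ℙ ℂ (Fin N → ℂ)) :=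
  {p | ∀ (d : ℕ) (F : MvPolynomial (Fin N) ℂ), F.IsHomogeneous d →
    (∀ q ∈ S, eval q.rep F = 0) → eval p.rep F = 0}

/-- The homogeneous ideal generated by the homogeneous polynomials that vanish on `S`. -/
def vanishingIdeal {N : ℕ} (S : Set (ℙ ℂ (Fin N → ℂ))) : Ideal (MvPolynomial (Fin N) ℂ) :=
  Ideal.span {F | (∃ d, F.IsHomogeneous d) ∧ ∀ q ∈ S, eval q.rep F = 0}

/-- The homogeneous coordinate ring `ℂ[x₁, …, x_N] / I(S)`. -/
abbrev CoordRing {N : ℕ} (S : Set (ℙ ℂ (Fin N → ℂ))) : Type :=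
  MvPolynomial (Fin N) ℂ ⧸ vanishingIdeal S

/-- The grading of the homogeneous coordinate ring by degree. -/
def coordGrading {N : ℕ} (S : Set (ℙ ℂ (Fin N → ℂ))) (d : ℕ) : Submodule ℂ (CoordRing S) :=
  (homogeneousSubmodule (Fin N) ℂ d).map (Ideal.Quotient.mkₐ ℂ (vanishingIdeal S)).toLinearMap

instance coordGrading_gradedMonoid {N : ℕ} (S : Set (ℙ ℂ (Fin N → ℂ))) :
    SetLike.GradedMonoid (coordGrading S) where
  one_mem := ⟨1, isHomogeneous_one _ _, map_one (Ideal.Quotient.mkₐ ℂ (vanishingIdeal S))⟩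
  mul_mem := by
    rintro i j _ _ ⟨f, hf, rfl⟩ ⟨g, hg, rfl⟩
    exact ⟨f * g, IsHomogeneous.mul hf hg, map_mul (Ideal.Quotient.mkₐ ℂ (vanishingIdeal S)) f g⟩

/-- The decomposition of a polynomial into the classes of its homogeneous components. -/
def coordDecompAux {N : ℕ} (S : Set (ℙ ℂ (Fin N → ℂ))) :
    MvPolynomial (Fin N) ℂ →ₐ[ℂ] ⨁ d, coordGrading S d :=
  letI : GradedAlgebra (homogeneousSubmodule (Fin N) ℂ) := MvPolynomial.gradedAlgebra
  (DirectSum.toAlgebra ℂ (fun d => homogeneousSubmodule (Fin N) ℂ d)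
    (fun d => (DirectSum.lof ℂ ℕ (fun d => coordGrading S d) d).comp
      ((Ideal.Quotient.mkₐ ℂ (vanishingIdeal S)).toLinearMap.submoduleMap
        (homogeneousSubmodule (Fin N) ℂ d)))
    rfl (fun a b => by
      refine Eq.trans ?_ (DirectSum.of_mul_of (A := fun d => coordGrading S d) _ _).symm
      exact congrArg (DirectSum.of (fun d => coordGrading S d) _) (Subtype.ext
        (map_mul (Ideal.Quotient.mkₐ ℂ (vanishingIdeal S)) a.1 b.1)))).comp
  (DirectSum.decomposeAlgEquiv (homogeneousSubmodule (Fin N) ℂ)).toAlgHom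

lemma coordDecompAux_apply {N : ℕ} (S : Set (ℙ ℂ (Fin N → ℂ))) (d : ℕ)
    (F : MvPolynomial (Fin N) ℂ) (hF : F.IsHomogeneous d) :
    coordDecompAux S F = DirectSum.of (fun d => coordGrading S d) d
      ⟨Ideal.Quotient.mk _ F, F, hF, rfl⟩ := by
  let _ : GradedAlgebra (homogeneousSubmodule (Fin N) ℂ) := MvPolynomial.gradedAlgebra
  have h : DirectSum.decompose (homogeneousSubmodule (Fin N) ℂ) F =
      DirectSum.of (fun d => homogeneousSubmodule (Fin N) ℂ d) d ⟨F, hF⟩ :=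
    DirectSum.decompose_of_mem _ hF
  rw [coordDecompAux, AlgHom.comp_apply]
  change DirectSum.toAlgebra ℂ (fun d => homogeneousSubmodule (Fin N) ℂ d) _ _ _
    (DirectSum.decompose (homogeneousSubmodule (Fin N) ℂ) F) = _
  rw [h]
  exact DirectSum.toAddMonoid_of _ _ _

instance coordGrading_gradedAlgebra {N : ℕ} (S : Set (ℙ ℂ (Fin N → ℂ))) :
    GradedAlgebra (coordGrading S) :=
  GradedAlgebra.ofAlgHom _
    (Ideal.Quotient.liftₐ (vanishingIdeal S) (coordDecompAux S) (by
      suffices h : vanishingIdeal S ≤ RingHom.ker (coordDecompAux S) from fun a ha => h ha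
      refine Ideal.span_le.mpr ?_
      rintro F ⟨⟨d, hd⟩, hF⟩
      have h0 : Ideal.Quotient.mk (vanishingIdeal S) F = 0 :=
        Ideal.Quotient.eq_zero_iff_mem.mpr (Ideal.subset_span ⟨⟨d, hd⟩, hF⟩)
      rw [SetLike.mem_coe, RingHom.mem_ker, coordDecompAux_apply S d F hd]
      simp only [h0]
      exact map_zero _))
    (by
      refine Ideal.Quotient.algHom_ext _ ?_
      refine MvPolynomial.algHom_ext fun i => ?_
      change DirectSum.coeAlgHom _ (coordDecompAux S (X i)) = _
      rw [coordDecompAux_apply S 1 (X i) (isHomogeneous_X _ _), DirectSum.coeAlgHom_of]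
      rfl)
    (by
      rintro d ⟨_, F, hF, rfl⟩
      exact coordDecompAux_apply S d F hF)

/-- A closed subset of `ℙ^{N-1}` as a reduced projective scheme over `ℂ`: `Proj` of its
homogeneous coordinate ring. -/
def projVariety {N : ℕ} (S : Set (ℙ ℂ (Fin N → ℂ))) : Over (Spec (CommRingCat.of ℂ)) :=
  projOver (coordGrading S)

/-! ## The Segre coefficient variety -/

/-- The Segre coefficient variety: the Zariski closure of the image of `π`, in the homogeneous
coordinates on `ℙ H⁰(Gr(ℓ, kℓ), 𝒪(k))` given by a basis `e`. -/
def coeffVariety {k ℓ N : ℕ} (e : Module.Basis (Fin N) ℂ (grSections ℓ (k * ℓ) k)) :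
    Set (ℙ ℂ (Fin N → ℂ)) :=
  zariskiClosure {p | ∃ (W : Gr k (k * ℓ)) (hW : W.IsUniform),
    p = Projectivization.map e.equivFun.toLinearMap e.equivFun.injective (segreMap W hW)}

/-! ## The GIT quotient `(ℙ¹)ⁿ // SL₂` -/

/-- The `SL₂`-invariants in `H⁰((ℙ¹)ⁿ, 𝒪(d, …, d))`: the polynomials in the entries of a `2 × n`
matrix `A` (the columns being the homogeneous coordinates of the `n` points) that are homogeneous
of degree `d` in each column and satisfy `f(g A) = f(A)` for all `g ∈ SL₂`. -/
def gitInvariants (n d : ℕ) : Submodule ℂ (MvPolynomial (Fin 2 × Fin n) ℂ) where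
  carrier := {f | IsWeightedHomogeneous (fun p : Fin 2 × Fin n => (Pi.single p.2 1 : Fin n → ℕ)) f
      (fun _ => d) ∧
    ∀ g : Matrix.SpecialLinearGroup (Fin 2) ℂ, leftSubst n g.1 f = f}
  zero_mem' := ⟨isWeightedHomogeneous_zero _ _ _, fun g => map_zero _⟩
  add_mem' := fun {f f'} hf hf' => ⟨hf.1.add hf'.1, fun g => by rw [map_add, hf.2 g, hf'.2 g]⟩
  smul_mem' := fun c f hf => ⟨(weightedHomogeneousSubmodule ℂ _ _).smul_mem c hf.1,
    fun g => by rw [map_smul, hf.2 g]⟩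

instance gitInvariants_gradedMonoid (n : ℕ) : SetLike.GradedMonoid (gitInvariants n) where
  one_mem := ⟨isWeightedHomogeneous_one _ _, fun g => map_one _⟩
  mul_mem := fun {i j f f'} hf hf' => ⟨hf.1.mul hf'.1, fun g => by rw [map_mul, hf.2 g, hf'.2 g]⟩

/-- The graded ring `R = ⨁_d H⁰((ℙ¹)ⁿ, 𝒪(d, …, d))^{SL₂}`. -/
def GitRing (n : ℕ) : Type := ⨁ d, gitInvariants n d

instance (n : ℕ) : CommRing (GitRing n) := inferInstanceAs (CommRing (⨁ d, gitInvariants n d))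

instance (n : ℕ) : Algebra ℂ (GitRing n) := inferInstanceAs (Algebra ℂ (⨁ d, gitInvariants n d))

/-- The inclusion of the `d`-th summand. -/
def gitOf (n d : ℕ) : gitInvariants n d →ₗ[ℂ] GitRing n :=
  DirectSum.lof ℂ ℕ (fun d => gitInvariants n d) d

/-- The `d`-th graded piece of `R`. -/
def gitGrading (n d : ℕ) : Submodule ℂ (GitRing n) := LinearMap.range (gitOf n d)

lemma gitOf_mul (n : ℕ) {i j : ℕ} (f : gitInvariants n i) (g : gitInvariants n j) :
    gitOf n (i + j) (GradedMonoid.GMul.mul (A := fun d => gitInvariants n d) f g) =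
      gitOf n i f * gitOf n j g :=
  (DirectSum.of_mul_of (A := fun d => gitInvariants n d) f g).symm

instance gitGrading_gradedMonoid (n : ℕ) : SetLike.GradedMonoid (gitGrading n) where
  one_mem := ⟨GradedMonoid.GOne.one (A := fun d => gitInvariants n d), rfl⟩
  mul_mem := by
    rintro i j _ _ ⟨f, rfl⟩ ⟨g, rfl⟩
    exact ⟨_, gitOf_mul n f g⟩

/-- The decomposition of an element of `R` into its components. -/
def gitDecomp (n : ℕ) : GitRing n →ₐ[ℂ] ⨁ d, gitGrading n d :=
  DirectSum.toAlgebra ℂ (fun d => gitInvariants n d)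
    (fun d => (DirectSum.lof ℂ ℕ (fun d => gitGrading n d) d).comp (gitOf n d).rangeRestrict)
    rfl (fun a b => by
      refine Eq.trans ?_ (DirectSum.of_mul_of (A := fun d => gitGrading n d) _ _).symm
      exact congrArg (DirectSum.of (fun d => gitGrading n d) _) (Subtype.ext (gitOf_mul n a b)))

lemma gitDecomp_gitOf (n d : ℕ) (f : gitInvariants n d) :
    gitDecomp n (gitOf n d f) =
      DirectSum.of (fun d => gitGrading n d) d ⟨gitOf n d f, f, rfl⟩ :=
  DirectSum.toAddMonoid_of (β := fun d => gitInvariants n d)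
    (fun d => ((DirectSum.lof ℂ ℕ (fun d => gitGrading n d) d).comp
      (gitOf n d).rangeRestrict).toAddMonoidHom) d f

instance gitGrading_gradedAlgebra (n : ℕ) : GradedAlgebra (gitGrading n) :=
  GradedAlgebra.ofAlgHom _ (gitDecomp n)
    (by
      refine DirectSum.algHom_ext' ℂ (fun d => gitInvariants n d) fun d => LinearMap.ext fun f => ?_
      change DirectSum.coeAlgHom _ (gitDecomp n (gitOf n d f)) = gitOf n d f
      rw [gitDecomp_gitOf, DirectSum.coeAlgHom_of])
    (by
      rintro d ⟨_, f, rfl⟩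
      exact gitDecomp_gitOf n d f)

/-- The GIT quotient `(ℙ¹)ⁿ // SL₂` with respect to the linearization `(1, …, 1)`. -/
def gitQuotient (n : ℕ) : Over (Spec (CommRingCat.of ℂ)) :=
  projOver (gitGrading n)

end SegreCoeff

end

/-
The coefficients of `Seg(A, B)`, as a polynomial in `B`, are `SL₂`-invariant and of degree one in
each column of `A`. By the first fundamental theorem such invariants are combinations of bracket
monomials, the products of `2 × 2` minors of `A` over the edges of a multigraph on the columns.
Plücker relations make the multigraph bipartite, and a regular bipartite multigraph splits into
perfect matchings (Kempe). So the invariant ring of `2ℓ` points on the line is generated in degree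
one by the matching polynomials, the products of minors over a perfect matching. Setting the columns
of `B` to unit vectors shows that each matching polynomial is a coefficient of `Seg(A, B)`; hence
the homogeneous coordinate ring of the coefficient variety is the whole invariant ring.

Exchanging the ends of two edges of a perfect matching multiplies the matching polynomial by a
cross-ratio of four columns. So `π(A)` determines all cross-ratios of the columns of `A`, which
determine `A` up to the torus. Conversely, proportionality of the matching polynomials is a closed
condition on the Grassmannian that holds on a torus orbit.
-/

noncomputable section

namespace SegreCoeff

section ProjIso

open HomogeneousIdeal

universe u

variable {A B : Type u} [CommRing A] [CommRing B]

section GradedRing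

variable {σ τ : Type u} [SetLike σ A] [AddSubgroupClass σ A] [SetLike τ B] [AddSubgroupClass τ B]
  {𝒜 : ℕ → σ} {ℬ : ℕ → τ} [GradedRing 𝒜] [GradedRing ℬ]

lemma irrelevant_le_map_of_surjective (f : 𝒜 →+*ᵍ ℬ) (hf : ∀ d, ∀ b ∈ ℬ d, ∃ a ∈ 𝒜 d, f a = b) :
    ℬ₊ ≤ 𝒜₊.map f := by
  rw [← toIdeal_le_toIdeal_iff, toIdeal_map, toIdeal_irrelevant_le]
  intro d hd b hb
  obtain ⟨a, ha, rfl⟩ := hf d b hb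
  exact Ideal.mem_map_of_mem _ (mem_irrelevant_of_mem 𝒜 hd ha)

lemma projMap_comp_toSpecZero (f : 𝒜 →+*ᵍ ℬ) (hf : ℬ₊ ≤ 𝒜₊.map f) :
    Proj.map f hf ≫ Proj.toSpecZero 𝒜 =
      Proj.toSpecZero ℬ ≫ Spec.map (CommRingCat.ofHom f.gradedZeroRingHom) := by
  have on_chart {i : ℕ} (hi : 0 < i) (s : A) (hs : s ∈ 𝒜 i) :
      Proj.awayι ℬ (f s) (f.2 hs) hi ≫ Proj.map f hf ≫ Proj.toSpecZero 𝒜 =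
        Proj.awayι ℬ (f s) (f.2 hs) hi ≫ Proj.toSpecZero ℬ ≫
          Spec.map (CommRingCat.ofHom f.gradedZeroRingHom) := by
    rw [Proj.awayι_comp_map_assoc f hf hi s hs, Proj.awayι_toSpecZero,
      Proj.awayι_toSpecZero_assoc, ← Spec.map_comp, ← Spec.map_comp, ← CommRingCat.ofHom_comp,
      ← CommRingCat.ofHom_comp]
    congr 2
    refine RingHom.ext fun a => ?_
    refine (HomogeneousLocalization.map_mk f (by rintro _ ⟨n, rfl⟩; exact ⟨n, by simp⟩) _).trans ?_
    exact congrArg HomogeneousLocalization.mk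
      (HomogeneousLocalization.NumDenSameDeg.ext _ rfl rfl (map_one f))
  exact (Proj.mapAffineOpenCover f hf).openCover.hom_ext _ _ fun s =>
    on_chart s.1.2 s.2.1 s.2.2

lemma projMap_comp_projMap_eq_id (f : 𝒜 →+*ᵍ ℬ) (g : ℬ →+*ᵍ 𝒜) (hf : ℬ₊ ≤ 𝒜₊.map f)
    (hg : 𝒜₊ ≤ ℬ₊.map g) (h : g.comp f = .id 𝒜) :
    Proj.map g hg ≫ Proj.map f hf = 𝟙 (Proj 𝒜) := by
  rw [← Proj.map_comp, ← Proj.map_id]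
  congr 1

end GradedRing

theorem nonempty_projOver_iso {A B : Type} [CommRing A] [Algebra ℂ A] [CommRing B] [Algebra ℂ B]
    {𝒜 : ℕ → Submodule ℂ A} {ℬ : ℕ → Submodule ℂ B} [GradedAlgebra 𝒜] [GradedAlgebra ℬ]
    (f : A ≃ₐ[ℂ] B) (hf : ∀ d, (𝒜 d).map f.toLinearMap = ℬ d) :
    Nonempty (projOver 𝒜 ≅ projOver ℬ) := by
  have symm_mem : ∀ d, ∀ b ∈ ℬ d, f.symm b ∈ 𝒜 d := by
    intro d b hb
    obtain ⟨a, ha, rfl⟩ := hf d ▸ hb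
    simpa using ha
  let F : 𝒜 →+*ᵍ ℬ := ⟨f.toRingEquiv.toRingHom, fun {i x} hx => hf i ▸ ⟨x, hx, rfl⟩⟩
  let G : ℬ →+*ᵍ 𝒜 := ⟨f.symm.toRingEquiv.toRingHom, fun {i x} hx => symm_mem i x hx⟩
  have hF := irrelevant_le_map_of_surjective F fun d b hb => ⟨G b, G.2 hb, f.apply_symm_apply b⟩
  have hG := irrelevant_le_map_of_surjective G fun d a ha => ⟨F a, F.2 ha, f.symm_apply_apply a⟩
  have over_ℂ : Proj.map G hG ≫ (projOver ℬ).hom = (projOver 𝒜).hom := by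
    change Proj.map G hG ≫ Proj.toSpecZero ℬ ≫ _ = Proj.toSpecZero 𝒜 ≫ _
    rw [← Category.assoc, projMap_comp_toSpecZero, Category.assoc, ← Spec.map_comp,
      ← CommRingCat.ofHom_comp]
    congr 3
    exact RingHom.ext fun c => Subtype.ext (f.symm.commutes c)
  exact ⟨Over.isoMk ⟨Proj.map G hG, Proj.map F hF,
    projMap_comp_projMap_eq_id F G hF hG (DFunLike.ext _ _ f.symm_apply_apply),
    projMap_comp_projMap_eq_id G F hG hF (DFunLike.ext _ _ f.apply_symm_apply)⟩ over_ℂ⟩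

end ProjIso

section Minors

variable {R ι : Type*} [CommRing R]

/-- The `2 × 2` minor of `A` in the columns `a` and `b`, in this order. -/
def colMinor (A : Matrix (Fin 2) ι R) (a b : ι) : R :=
  A 0 a * A 1 b - A 0 b * A 1 a

lemma colMinor_swap (A : Matrix (Fin 2) ι R) (a b : ι) : colMinor A b a = -colMinor A a b := by
  simp only [colMinor]; ring

lemma colMinor_eq_det (A : Matrix (Fin 2) ι R) (v : Fin 2 → ι) :
    colMinor A (v 0) (v 1) = (A.submatrix id v).det := by
  simp [colMinor, Matrix.det_fin_two]

lemma colMinor_plucker (A : Matrix (Fin 2) ι R) (a b c d : ι) :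
    colMinor A a b * colMinor A c d =
      colMinor A a c * colMinor A b d - colMinor A a d * colMinor A b c := by
  simp only [colMinor]; ring

lemma colMinor_mul (g : Matrix (Fin 2) (Fin 2) R) (A : Matrix (Fin 2) ι R) (a b : ι) :
    colMinor (g * A) a b = g.det * colMinor A a b := by
  simp only [colMinor, Matrix.mul_apply, Fin.sum_univ_two, Matrix.det_fin_two]; ring

lemma colMinor_mul_diagonal [Fintype ι] [DecidableEq ι] (A : Matrix (Fin 2) ι R) (t : ι → R)
    (a b : ι) : colMinor (A * Matrix.diagonal t) a b = t a * t b * colMinor A a b := by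
  simp only [colMinor, Matrix.mul_diagonal]; ring

/-- Cramer's rule. -/
lemma colMinor_mul_apply (A : Matrix (Fin 2) ι R) (a b c : ι) (i : Fin 2) :
    colMinor A a b * A i c = colMinor A c b * A i a + colMinor A a c * A i b := by
  fin_cases i <;> simp only [colMinor, Fin.zero_eta, Fin.mk_one] <;> ring

/-- The bracket `[a b]`: the minor of the generic `2 × n` matrix in the columns `a` and `b`. -/
def bracket (a b : ι) : MvPolynomial (Fin 2 × ι) ℂ :=
  colMinor (Matrix.mvPolynomialX (Fin 2) ι ℂ) a b

lemma eval_bracket (A : Matrix (Fin 2) ι ℂ) (a b : ι) :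
    eval (fun p => A p.1 p.2) (bracket a b) = colMinor A a b := by
  simp [bracket, colMinor]

lemma bracket_swap (a b : ι) : bracket b a = -bracket a b := colMinor_swap _ a b

lemma not_X_dvd_bracket {a b : ι} (hab : a ≠ b) : ¬ X (0, a) ∣ bracket a b := by
  classical
  rintro ⟨q, hq⟩
  have := congrArg (eval fun p : Fin 2 × ι => if p = (0, a) then 0 else 1) hq
  simp [bracket, colMinor, hab.symm] at this

lemma bracket_ne_zero {a b : ι} (hab : a ≠ b) : bracket a b ≠ 0 :=
  fun h => not_X_dvd_bracket hab (h ▸ dvd_zero _)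

end Minors

section Multigraphs

variable {ι : Type*}

/-- The bracket monomial of a multigraph on the columns, given by the multiset of its edges. -/
def bracketMonomial (E : Multiset (ι × ι)) : MvPolynomial (Fin 2 × ι) ℂ :=
  (E.map fun e => bracket e.1 e.2).prod

@[simp] lemma bracketMonomial_zero : bracketMonomial (0 : Multiset (ι × ι)) = 1 := rfl

@[simp] lemma bracketMonomial_cons (e : ι × ι) (E : Multiset (ι × ι)) :
    bracketMonomial (e ::ₘ E) = bracket e.1 e.2 * bracketMonomial E := by simp [bracketMonomial]

lemma bracketMonomial_add (E E' : Multiset (ι × ι)) :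
    bracketMonomial (E + E') = bracketMonomial E * bracketMonomial E' := by simp [bracketMonomial]

lemma bracketMonomial_exchange (a b c d : ι) (E : Multiset (ι × ι)) :
    bracketMonomial ((a, b) ::ₘ (c, d) ::ₘ E) =
      bracketMonomial ((a, c) ::ₘ (b, d) ::ₘ E) - bracketMonomial ((a, d) ::ₘ (b, c) ::ₘ E) := by
  simp only [bracketMonomial_cons, ← mul_assoc, ← sub_mul, bracket, colMinor_plucker _ a b c d]

variable [DecidableEq ι]

/-- The vertex degrees of a multigraph. -/
def multidegree (E : Multiset (ι × ι)) : ι → ℕ :=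
  (E.map fun e => Pi.single e.1 1 + Pi.single e.2 1).sum

@[simp] lemma multidegree_zero : multidegree (0 : Multiset (ι × ι)) = 0 := rfl

@[simp] lemma multidegree_cons (e : ι × ι) (E : Multiset (ι × ι)) :
    multidegree (e ::ₘ E) = Pi.single e.1 1 + Pi.single e.2 1 + multidegree E := by
  simp [multidegree]

lemma multidegree_add (E E' : Multiset (ι × ι)) :
    multidegree (E + E') = multidegree E + multidegree E' := by simp [multidegree]

/-- The span of the bracket monomials of multidegree `δ`. -/
def bracketSpan (δ : ι → ℕ) : Submodule ℂ (MvPolynomial (Fin 2 × ι) ℂ) :=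
  Submodule.span ℂ (bracketMonomial '' {E | multidegree E = δ})

lemma bracketMonomial_mem_bracketSpan (E : Multiset (ι × ι)) :
    bracketMonomial E ∈ bracketSpan (multidegree E) :=
  Submodule.subset_span ⟨E, rfl, rfl⟩

lemma bracket_mul_mem_bracketSpan (a b : ι) {δ : ι → ℕ} {f : MvPolynomial (Fin 2 × ι) ℂ}
    (hf : f ∈ bracketSpan δ) :
    bracket a b * f ∈ bracketSpan (Pi.single a 1 + Pi.single b 1 + δ) := by
  suffices bracketSpan δ ≤ (bracketSpan (Pi.single a 1 + Pi.single b 1 + δ)).comap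
    (LinearMap.mulLeft ℂ (bracket a b)) from this hf
  refine Submodule.span_le.mpr ?_
  rintro _ ⟨E, rfl, rfl⟩
  simpa using bracketMonomial_mem_bracketSpan ((a, b) ::ₘ E)

end Multigraphs

section ColumnDegrees

variable {K S ρ ι : Type*} [CommSemiring K] [CommSemiring S] [Algebra K S]

/-- The weights that grade the polynomials in the entries of a matrix by the degree in each of its
columns. -/
abbrev colWeight (ρ ι : Type*) [DecidableEq ι] : ρ × ι → (ι → ℕ) := fun p => Pi.single p.2 1

variable [DecidableEq ι]

lemma prod_col_pow [Fintype ι] (s : ι → S) (d : ρ × ι →₀ ℕ) :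
    (d.prod fun p k => s p.2 ^ k) = ∏ c, s c ^ Finsupp.weight (colWeight ρ ι) d c := by
  classical
  induction d using Finsupp.induction_linear with
  | zero => simp
  | add d d' h h' =>
    rw [Finsupp.prod_add_index' (by simp) (by simp [pow_add]), h, h', ← Finset.prod_mul_distrib]
    simp [pow_add]
  | single p k =>
    rw [Finsupp.prod_single_index (by simp), Finset.prod_eq_single p.2] <;>
      simp +contextual [Finsupp.weight_single]

lemma aeval_mul_of_isWeightedHomogeneous [Fintype ι] (s : ι → S) (x : ρ × ι → S)
    {f : MvPolynomial (ρ × ι) K} {δ : ι → ℕ} (hf : IsWeightedHomogeneous (colWeight ρ ι) f δ) :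
    aeval (fun p => s p.2 * x p) f = (∏ c, s c ^ δ c) * aeval x f := by
  induction hf using IsWeightedHomogeneous.induction_on with
  | zero => simp
  | add p q _ _ hp hq => rw [map_add, map_add, hp, hq, mul_add]
  | monomial d r hr =>
    rw [aeval_monomial, aeval_monomial, ← hr, ← prod_col_pow]
    simp only [mul_pow, Finsupp.prod_mul]
    ring

lemma eval_mul_of_isWeightedHomogeneous [Fintype ι] (s : ι → K) (x : ρ × ι → K)
    {f : MvPolynomial (ρ × ι) K} {δ : ι → ℕ} (hf : IsWeightedHomogeneous (colWeight ρ ι) f δ) :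
    eval (fun p => s p.2 * x p) f = (∏ c, s c ^ δ c) * eval x f := by
  simpa [aeval_eq_eval] using aeval_mul_of_isWeightedHomogeneous s x hf

lemma eval_congr_of_isWeightedHomogeneous [Finite ι] {x y : ρ × ι → K}
    {f : MvPolynomial (ρ × ι) K} {δ : ι → ℕ} (hf : IsWeightedHomogeneous (colWeight ρ ι) f δ)
    (h : ∀ p, δ p.2 ≠ 0 → x p = y p) : eval x f = eval y f := by
  have := Fintype.ofFinite ι
  let s : ι → K := fun c => if δ c = 0 then 0 else 1
  have eval_s (z : ρ × ι → K) : eval (fun p => s p.2 * z p) f = eval z f := by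
    rw [eval_mul_of_isWeightedHomogeneous s z hf, Finset.prod_eq_one, one_mul]
    intro c _
    by_cases hc : δ c = 0 <;> simp [s, hc]
  rw [← eval_s x, ← eval_s y]
  congr 2 with p
  by_cases hp : δ p.2 = 0
  · simp [s, hp]
  · rw [h p hp]

end ColumnDegrees

lemma eval_leftSubst {m n : ℕ} (g : Matrix (Fin m) (Fin m) ℂ) (A : Matrix (Fin m) (Fin n) ℂ)
    (f : MvPolynomial (Fin m × Fin n) ℂ) :
    eval (fun p => A p.1 p.2) (leftSubst n g f) = eval (fun p => (g * A) p.1 p.2) f := by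
  have h : (aeval fun p => A p.1 p.2).comp (leftSubst n g) =
      aeval (R := ℂ) fun p : Fin m × Fin n => (g * A) p.1 p.2 :=
    MvPolynomial.algHom_ext fun p => by simp [leftSubst, aeval_eq_eval, Matrix.mul_apply]
  simpa [aeval_eq_eval] using DFunLike.congr_fun h f

section Invariants

variable {m n n' : ℕ}

/-- The `SL_m`-invariant polynomials in the entries of an `m × n` matrix that are homogeneous of
degree `δ c` in the `c`-th column, for every `c`. -/
def invariants (m : ℕ) {n : ℕ} (δ : Fin n → ℕ) :
    Submodule ℂ (MvPolynomial (Fin m × Fin n) ℂ) where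
  carrier := {f | IsWeightedHomogeneous (colWeight (Fin m) (Fin n)) f δ ∧
    ∀ g : Matrix.SpecialLinearGroup (Fin m) ℂ, leftSubst n g.1 f = f}
  zero_mem' := ⟨isWeightedHomogeneous_zero _ _ _, fun g => map_zero _⟩
  add_mem' := fun {f f'} hf hf' => ⟨hf.1.add hf'.1, fun g => by rw [map_add, hf.2 g, hf'.2 g]⟩
  smul_mem' := fun c f hf => ⟨(weightedHomogeneousSubmodule ℂ _ _).smul_mem c hf.1,
    fun g => by rw [map_smul, hf.2 g]⟩

lemma one_mem_invariants : (1 : MvPolynomial (Fin m × Fin n) ℂ) ∈ invariants m 0 :=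
  ⟨isWeightedHomogeneous_one _ _, fun _ => map_one _⟩

lemma mul_mem_invariants {δ δ' : Fin n → ℕ} {f f' : MvPolynomial (Fin m × Fin n) ℂ}
    (hf : f ∈ invariants m δ) (hf' : f' ∈ invariants m δ') : f * f' ∈ invariants m (δ + δ') :=
  ⟨hf.1.mul hf'.1, fun g => by rw [map_mul, hf.2 g, hf'.2 g]⟩

lemma mem_invariants_of_mul_mem {δ δ' : Fin n → ℕ} {f f' : MvPolynomial (Fin m × Fin n) ℂ}
    (hf : f ∈ invariants m δ) (hf0 : f ≠ 0) (h : f * f' ∈ invariants m (δ + δ')) :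
    f' ∈ invariants m δ' := by
  refine ⟨?_, fun g => mul_left_cancel₀ hf0 ?_⟩
  · let 𝒢 := weightedHomogeneousSubmodule ℂ (colWeight (Fin m) (Fin n))
    let _ : GradedAlgebra 𝒢 := weightedGradedAlgebra ℂ _
    have key := DirectSum.coe_decompose_mul_add_of_left_mem 𝒢 (b := f') (j := δ') hf.1
    rw [DirectSum.decompose_of_mem_same 𝒢 h.1] at key
    rw [mul_left_cancel₀ hf0 key]
    exact (DirectSum.decompose 𝒢 f' δ').2
  · simpa only [map_mul, hf.2 g] using h.2 g

lemma eval_mul_of_mem_invariants {δ : Fin n → ℕ} {f : MvPolynomial (Fin m × Fin n) ℂ}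
    (hf : f ∈ invariants m δ) (g : Matrix.SpecialLinearGroup (Fin m) ℂ)
    (A : Matrix (Fin m) (Fin n) ℂ) :
    eval (fun p => (g.1 * A) p.1 p.2) f = eval (fun p => A p.1 p.2) f := by
  rw [← eval_leftSubst, hf.2 g]

lemma exists_eq_C_of_mem_invariants_zero {f : MvPolynomial (Fin m × Fin n) ℂ}
    (hf : f ∈ invariants m 0) : ∃ a, f = C a :=
  ⟨eval 0 f, MvPolynomial.funext fun x => by
    rw [eval_C, eval_congr_of_isWeightedHomogeneous hf.1 (y := 0) (by simp)]⟩

/-- Substituting the `r c`-th column for the `c`-th one. -/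
def mergeColumns (r : Fin n → Fin n') :
    MvPolynomial (Fin m × Fin n) ℂ →ₐ[ℂ] MvPolynomial (Fin m × Fin n') ℂ :=
  rename (Prod.map id r)

lemma weight_mapDomain (r : Fin n → Fin n') (d : Fin m × Fin n →₀ ℕ) :
    Finsupp.weight (colWeight (Fin m) (Fin n')) (d.mapDomain (Prod.map id r)) =
      FunOnFinite.linearMap ℕ ℕ r (Finsupp.weight (colWeight (Fin m) (Fin n)) d) := by
  induction d using Finsupp.induction_linear with
  | zero => simp
  | add d d' h h' => rw [Finsupp.mapDomain_add, map_add, map_add, map_add, h, h']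
  | single p k =>
    rw [Finsupp.mapDomain_single, Finsupp.weight_single, Finsupp.weight_single, map_nsmul,
      FunOnFinite.linearMap_piSingle]
    rfl

lemma mergeColumns_mem_invariants (r : Fin n → Fin n') {δ : Fin n → ℕ}
    {f : MvPolynomial (Fin m × Fin n) ℂ} (hf : f ∈ invariants m δ) :
    mergeColumns r f ∈ invariants m (FunOnFinite.linearMap ℕ ℕ r δ) := by
  refine ⟨?_, fun g => ?_⟩
  · obtain ⟨hom, -⟩ := hf
    induction hom using IsWeightedHomogeneous.induction_on with
    | zero => rw [map_zero]; exact isWeightedHomogeneous_zero _ _ _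
    | add p q _ _ hp hq =>
      rw [map_add]
      exact hp.add hq
    | monomial d a hd =>
      rw [mergeColumns, rename_monomial]
      exact isWeightedHomogeneous_monomial _ _ _ (by rw [weight_mapDomain, hd])
  · have comm : (leftSubst n' g.1).comp (mergeColumns r) =
        (mergeColumns r).comp (leftSubst n g.1) :=
      MvPolynomial.algHom_ext fun p => by simp [leftSubst, mergeColumns]
    rw [← AlgHom.comp_apply, comm, AlgHom.comp_apply, hf.2 g]

end Invariants

lemma aeval_sub_aeval_mem {K S σ : Type*} [CommSemiring K] [CommRing S] [Algebra K S] {I : Ideal S}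
    {x y : σ → S} (h : ∀ i, x i - y i ∈ I) (f : MvPolynomial σ K) :
    aeval x f - aeval y f ∈ I := by
  have : (Ideal.Quotient.mkₐ K I).comp (aeval x) = (Ideal.Quotient.mkₐ K I).comp (aeval y) :=
    MvPolynomial.algHom_ext fun i => by simpa using Ideal.Quotient.eq.mpr (h i)
  exact Ideal.Quotient.eq.mp (DFunLike.congr_fun this f)

section FirstFundamentalTheorem

variable {n n' : ℕ}

lemma bracket_mem_invariants (a b : Fin n) :
    bracket a b ∈ invariants 2 (Pi.single a 1 + Pi.single b 1) := by
  refine ⟨?_, fun g => MvPolynomial.funext fun x => ?_⟩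
  · have X_hom : ∀ p : Fin 2 × Fin n, IsWeightedHomogeneous (colWeight (Fin 2) (Fin n))
      (X p : MvPolynomial _ ℂ) (Pi.single p.2 1) := fun p => isWeightedHomogeneous_X _ _ p
    refine ((X_hom (0, a)).mul (X_hom (1, b))).sub ?_
    rw [add_comm]
    exact (X_hom (0, b)).mul (X_hom (1, a))
  · have h := eval_leftSubst g.1 (Matrix.of fun i j => x (i, j)) (bracket a b)
    rwa [eval_bracket, colMinor_mul, g.2, one_mul, ← eval_bracket] at h

lemma bracketSpan_le_invariants (δ : Fin n → ℕ) : bracketSpan δ ≤ invariants 2 δ := by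
  refine Submodule.span_le.mpr ?_
  rintro _ ⟨E, rfl, rfl⟩
  induction E using Multiset.induction_on with
  | empty => exact one_mem_invariants
  | cons e E ih =>
    rw [bracketMonomial_cons, multidegree_cons]
    exact mul_mem_invariants (bracket_mem_invariants _ _) ih

lemma eq_zero_of_mem_invariants_single {a : Fin n} {k : ℕ} (hk : k ≠ 0)
    {f : MvPolynomial (Fin 2 × Fin n) ℂ} (hf : f ∈ invariants 2 (Pi.single a k)) : f = 0 := by
  suffices h : X (0, a) * f = 0 from (mul_eq_zero.mp h).resolve_left (X_ne_zero _)
  refine MvPolynomial.funext fun x => ?_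
  rw [map_mul, eval_X, map_zero, mul_eq_zero, or_iff_not_imp_left]
  intro hx
  -- An element of `SL₂` that doubles the `a`-th column.
  let g : Matrix.SpecialLinearGroup (Fin 2) ℂ :=
    ⟨!![2, 0; 3 * x (1, a) / (2 * x (0, a)), 1 / 2], by simp [Matrix.det_fin_two_of]⟩
  have doubled : eval x f = 2 ^ k * eval x f := calc
    eval x f = eval (fun p => (g.1 * Matrix.of fun i j => x (i, j)) p.1 p.2) f :=
      (eval_mul_of_mem_invariants hf g (Matrix.of fun i j => x (i, j))).symm
    _ = eval (fun p => (2 : ℂ) * x p) f := by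
      refine eval_congr_of_isWeightedHomogeneous hf.1 fun ⟨i, c⟩ hc => ?_
      obtain rfl : c = a := by by_contra h; simp [h] at hc
      fin_cases i
      · simp [g, Matrix.mul_apply]
      · simp [g, Matrix.mul_apply]
        field_simp
        ring
    _ = 2 ^ k * eval x f := by
      rw [eval_mul_of_isWeightedHomogeneous (fun _ => 2) x hf.1]
      simp [Finset.prod_pow_eq_pow_sum]
  have two_pow_ne_one : (2 : ℂ) ^ k ≠ 1 := by exact_mod_cast (Nat.one_lt_two_pow hk).ne'
  exact (mul_eq_zero.mp (by linear_combination -doubled : (2 ^ k - 1) * eval x f = 0)).resolve_left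
    (sub_ne_zero.mpr two_pow_ne_one)

lemma bracket_dvd_sub_mergeColumns (a b : Fin n) {δ : Fin n → ℕ}
    {f : MvPolynomial (Fin 2 × Fin n) ℂ}
    (hf : IsWeightedHomogeneous (colWeight (Fin 2) (Fin n)) f δ) :
    bracket a b ∣
      X (0, a) ^ δ b * f - X (0, b) ^ δ b * mergeColumns (Function.update id b a) f := by
  let s (u : MvPolynomial (Fin 2 × Fin n) ℂ) : Fin n → MvPolynomial (Fin 2 × Fin n) ℂ :=
    Function.update 1 b u
  have scale (u) (x : Fin 2 × Fin n → MvPolynomial (Fin 2 × Fin n) ℂ) :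
      aeval (fun p => s u p.2 * x p) f = u ^ δ b * aeval x f := by
    rw [aeval_mul_of_isWeightedHomogeneous _ _ hf, Finset.prod_eq_single b] <;>
      simp +contextual [s]
  have merge : mergeColumns (Function.update id b a) f =
      aeval (fun p => X (p.1, Function.update id b a p.2)) f := by
    rw [mergeColumns, ← aeval_X_left_apply (rename _ f), aeval_rename]; rfl
  rw [merge, ← scale]
  nth_rw 1 [← AlgHom.id_apply (R := ℂ) f]
  rw [← aeval_X_left, ← scale, ← Ideal.mem_span_singleton]
  refine aeval_sub_aeval_mem (fun ⟨i, c⟩ => Ideal.mem_span_singleton.mpr ?_) f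
  obtain rfl | hc := eq_or_ne c b
  · fin_cases i
    · exact ⟨0, by simp [s]; ring⟩
    · exact ⟨1, by simp [s, bracket, colMinor]⟩
  · simp [s, hc]

lemma bracket_dvd_of_mergeColumns_eq_zero {a b : Fin n} (hab : a ≠ b) {δ : Fin n → ℕ}
    {f : MvPolynomial (Fin 2 × Fin n) ℂ}
    (hf : IsWeightedHomogeneous (colWeight (Fin 2) (Fin n)) f δ)
    (h : mergeColumns (Function.update id b a) f = 0) : bracket a b ∣ f := by
  obtain ⟨q, hq⟩ := bracket_dvd_sub_mergeColumns a b hf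
  rw [h, mul_zero, sub_zero] at hq
  obtain ⟨q', rfl⟩ := X_prime.pow_dvd_of_dvd_mul_left _ (not_X_dvd_bracket hab) (Dvd.intro _ hq)
  refine ⟨q', mul_left_cancel₀ (pow_ne_zero (δ b) (X_ne_zero (0, a))) ?_⟩
  rw [hq, mul_left_comm]

lemma mergeColumns_bracket (r : Fin n → Fin n') (a b : Fin n) :
    mergeColumns r (bracket a b) = bracket (r a) (r b) := by
  simp [mergeColumns, bracket, colMinor]

lemma sum_linearMap (r : Fin n → Fin n') (δ : Fin n → ℕ) :
    ∑ c, FunOnFinite.linearMap ℕ ℕ r δ c = ∑ c, δ c := by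
  simp only [FunOnFinite.linearMap_apply_apply]
  exact Finset.sum_fiberwise _ _ _

lemma exists_eq_single_add {a : Fin n} {δ : Fin n → ℕ} (ha : δ a ≠ 0) :
    ∃ δ' : Fin n → ℕ, δ = Pi.single a 1 + δ' := by
  refine exists_add_of_le fun c => ?_
  obtain rfl | hc := eq_or_ne c a
  · simpa [Nat.one_le_iff_ne_zero] using ha
  · simp [hc]

lemma exists_of_linearMap_apply_ne_zero {r : Fin n → Fin n'} {δ : Fin n → ℕ} {i : Fin n'}
    (h : FunOnFinite.linearMap ℕ ℕ r δ i ≠ 0) : ∃ j, r j = i ∧ δ j ≠ 0 := by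
  rw [FunOnFinite.linearMap_apply_apply] at h
  obtain ⟨j, hj, hj'⟩ := Finset.exists_ne_zero_of_sum_ne_zero h
  exact ⟨j, by simpa using hj, hj'⟩

lemma exists_of_linearMap_eq_single_add {r : Fin n → Fin n'} {δ : Fin n → ℕ} {ε : Fin n' → ℕ}
    {i : Fin n'} (h : FunOnFinite.linearMap ℕ ℕ r δ = Pi.single i 1 + ε) :
    ∃ j δ', r j = i ∧ δ = Pi.single j 1 + δ' ∧ FunOnFinite.linearMap ℕ ℕ r δ' = ε := by
  obtain ⟨j, rfl, hj⟩ := exists_of_linearMap_apply_ne_zero (i := i) (by rw [h]; simp)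
  obtain ⟨δ', rfl⟩ := exists_eq_single_add hj
  rw [map_add, FunOnFinite.linearMap_piSingle] at h
  exact ⟨j, δ', rfl, rfl, add_left_cancel h⟩

lemma exists_bracketMonomial_lift (r : Fin n → Fin n') (E : Multiset (Fin n' × Fin n'))
    (δ : Fin n → ℕ) (h : FunOnFinite.linearMap ℕ ℕ r δ = multidegree E) :
    ∃ E', multidegree E' = δ ∧ mergeColumns r (bracketMonomial E') = bracketMonomial E := by
  induction E using Multiset.induction_on generalizing δ with
  | empty =>
    have sum_eq_zero : ∑ c, δ c = 0 := by rw [← sum_linearMap r, h]; simp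
    exact ⟨0, funext fun c => (Finset.sum_eq_zero_iff.mp sum_eq_zero c (Finset.mem_univ c)).symm,
      by simp⟩
  | cons e E ih =>
    rw [multidegree_cons, add_assoc] at h
    obtain ⟨i, δ₁, hi, rfl, h₁⟩ := exists_of_linearMap_eq_single_add h
    obtain ⟨j, δ₂, hj, rfl, h₂⟩ := exists_of_linearMap_eq_single_add h₁
    obtain ⟨E', rfl, hE'⟩ := ih δ₂ h₂
    refine ⟨(i, j) ::ₘ E', by simp [add_assoc], ?_⟩
    rw [bracketMonomial_cons, bracketMonomial_cons, map_mul, mergeColumns_bracket, hi, hj, hE']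

lemma bracketSpan_le_map_mergeColumns (r : Fin n → Fin n') (δ : Fin n → ℕ) :
    bracketSpan (FunOnFinite.linearMap ℕ ℕ r δ) ≤
      (bracketSpan δ).map (mergeColumns r).toLinearMap := by
  refine Submodule.span_le.mpr ?_
  rintro _ ⟨E, hE, rfl⟩
  obtain ⟨E', hE', h⟩ := exists_bracketMonomial_lift r E δ hE.symm
  exact ⟨_, Submodule.subset_span ⟨E', hE', rfl⟩, h⟩

lemma card_support_linearMap_lt {r : Fin n → Fin n'} {δ : Fin n → ℕ} {a b : Fin n} (hab : a ≠ b)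
    (hr : r a = r b) (ha : δ a ≠ 0) (hb : δ b ≠ 0) :
    Finset.card {c | FunOnFinite.linearMap ℕ ℕ r δ c ≠ 0} < Finset.card {c | δ c ≠ 0} := calc
  _ ≤ (Finset.image r {c | δ c ≠ 0}).card := Finset.card_le_card fun c hc => by
    obtain ⟨j, rfl, hj⟩ := exists_of_linearMap_apply_ne_zero (by simpa using hc)
    exact Finset.mem_image_of_mem r (by simpa using hj)
  _ < _ := Finset.card_image_le.lt_of_ne fun h =>
    hab (Finset.card_image_iff.mp h (by simpa using ha) (by simpa using hb) hr)

lemma eq_zero_or_eq_single_of_support_subsingleton {δ : Fin n → ℕ}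
    (h : ∀ a b, δ a ≠ 0 → δ b ≠ 0 → a = b) : δ = 0 ∨ ∃ a, ∃ k ≠ 0, δ = Pi.single a k := by
  refine or_iff_not_imp_left.mpr fun h0 => ?_
  obtain ⟨a, ha⟩ := Function.ne_iff.mp h0
  refine ⟨a, δ a, ha, funext fun c => ?_⟩
  obtain rfl | hc := eq_or_ne c a
  · simp
  · simpa [hc] using fun h' => hc (h c a h' ha)

/-- If `f'` lifts the image of `f` under merging the columns, then `f - f'` vanishes when the two
columns coincide, so it is divisible by their bracket. -/
lemma exists_eq_bracket_mul_add {δ : Fin n → ℕ} {a b : Fin n} (hab : a ≠ b)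
    {f : MvPolynomial (Fin 2 × Fin n) ℂ}
    (hf : f ∈ invariants 2 (Pi.single a 1 + Pi.single b 1 + δ))
    (hmerge : mergeColumns (Function.update id b a) f ∈ bracketSpan
      (FunOnFinite.linearMap ℕ ℕ (Function.update id b a) (Pi.single a 1 + Pi.single b 1 + δ))) :
    ∃ q ∈ invariants 2 δ, ∃ f' ∈ bracketSpan (Pi.single a 1 + Pi.single b 1 + δ),
      f = bracket a b * q + f' := by
  obtain ⟨f', hf', merge_eq⟩ := bracketSpan_le_map_mergeColumns _ _ hmerge
  have sub_mem' : f - f' ∈ invariants 2 (Pi.single a 1 + Pi.single b 1 + δ) :=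
    sub_mem hf (bracketSpan_le_invariants _ hf')
  obtain ⟨q, hq⟩ := bracket_dvd_of_mergeColumns_eq_zero hab sub_mem'.1
    (by rw [map_sub, sub_eq_zero]; exact merge_eq.symm)
  exact ⟨q, mem_invariants_of_mul_mem (bracket_mem_invariants a b) (bracket_ne_zero hab)
    (hq ▸ sub_mem'), f', hf', sub_eq_iff_eq_add.mp hq⟩

/-- The first fundamental theorem of invariant theory for `SL₂`. -/
theorem invariants_eq_bracketSpan (δ : Fin n → ℕ) : invariants 2 δ = bracketSpan δ := by
  refine le_antisymm ?_ (bracketSpan_le_invariants δ)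
  induction hm : ∑ c, δ c + Finset.card {c | δ c ≠ 0} using Nat.strong_induction_on
    generalizing δ with
  | _ m ih =>
  subst hm
  by_cases two_columns : ∃ a b, δ a ≠ 0 ∧ δ b ≠ 0 ∧ a ≠ b
  · obtain ⟨a, b, ha, hb, hab⟩ := two_columns
    intro f hf
    have merge_mem : mergeColumns (Function.update id b a) f ∈ bracketSpan
        (FunOnFinite.linearMap ℕ ℕ (Function.update id b a) δ) := by
      refine ih _ ?_ _ rfl (mergeColumns_mem_invariants _ hf)
      rw [sum_linearMap]
      exact Nat.add_lt_add_left (card_support_linearMap_lt hab (by simp [hab]) ha hb) _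
    obtain ⟨δ', rfl⟩ : ∃ δ', δ = Pi.single a 1 + Pi.single b 1 + δ' := by
      obtain ⟨δ₁, rfl⟩ := exists_eq_single_add ha
      obtain ⟨δ₂, rfl⟩ := exists_eq_single_add (a := b) (δ := δ₁) (by simpa [hab.symm] using hb)
      exact ⟨δ₂, (add_assoc _ _ _).symm⟩
    obtain ⟨q, hq, f', hf', rfl⟩ := exists_eq_bracket_mul_add hab hf merge_mem
    refine add_mem (bracket_mul_mem_bracketSpan a b (ih _ ?_ _ rfl hq)) hf'
    refine add_lt_add_of_lt_of_le ?_ (Finset.card_le_card fun c hc => ?_)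
    · simp [Finset.sum_add_distrib]
    · simp only [Finset.mem_filter_univ, Pi.add_apply] at hc ⊢
      lia
  · push Not at two_columns
    obtain rfl | ⟨a, k, hk, rfl⟩ := eq_zero_or_eq_single_of_support_subsingleton two_columns
    · intro f hf
      obtain ⟨c, rfl⟩ := exists_eq_C_of_mem_invariants_zero hf
      rw [← mul_one (C c), ← smul_eq_C_mul]
      exact Submodule.smul_mem _ _ (bracketMonomial_mem_bracketSpan 0)
    · intro f hf
      rw [eq_zero_of_mem_invariants_single hk hf]
      exact zero_mem _

end FirstFundamentalTheorem

section Bipartite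

variable {ι : Type*} [DecidableEq ι]

lemma sum_multidegree (S : Finset ι) (E : Multiset (ι × ι)) :
    ∑ c ∈ S, multidegree E c = E.countP (·.1 ∈ S) + E.countP (·.2 ∈ S) := by
  induction E using Multiset.induction_on with
  | empty => simp
  | cons e E ih =>
    simp only [multidegree_cons, Pi.add_apply, Finset.sum_add_distrib, ih,
      Finset.sum_pi_single', Multiset.countP_cons]
    ring

lemma countP_inside_eq_countP_outside [Fintype ι] {S : Finset ι} {E : Multiset (ι × ι)}
    (h : ∑ c ∈ S, multidegree E c = ∑ c ∈ Sᶜ, multidegree E c) :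
    E.countP (fun e => e.1 ∈ S ∧ e.2 ∈ S) = E.countP fun e => e.1 ∉ S ∧ e.2 ∉ S := by
  rw [sum_multidegree, sum_multidegree] at h
  suffices E.countP (·.1 ∈ S) + E.countP (·.2 ∈ S) + 2 * E.countP (fun e => e.1 ∉ S ∧ e.2 ∉ S) =
      E.countP (·.1 ∈ Sᶜ) + E.countP (·.2 ∈ Sᶜ) + 2 * E.countP (fun e => e.1 ∈ S ∧ e.2 ∈ S) by
    lia
  clear h
  induction E using Multiset.induction_on with
  | empty => rfl
  | cons e E ih =>
    simp only [Multiset.countP_cons, Finset.mem_compl] at ih ⊢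
    grind

/-- The span of the bracket monomials of multidegree `δ` all of whose edges lead from `S` to the
complement of `S`. -/
def bipartiteSpan (S : Finset ι) (δ : ι → ℕ) : Submodule ℂ (MvPolynomial (Fin 2 × ι) ℂ) :=
  Submodule.span ℂ (bracketMonomial '' {E | multidegree E = δ ∧ ∀ e ∈ E, e.1 ∈ S ∧ e.2 ∉ S})

lemma bracketMonomial_mem_bipartiteSpan_of_crossing {S : Finset ι} {E : Multiset (ι × ι)}
    (hE : ∀ e ∈ E, e.1 ∈ S ↔ e.2 ∉ S) : bracketMonomial E ∈ bipartiteSpan S (multidegree E) := by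
  suffices ∃ E' : Multiset (ι × ι), multidegree E' = multidegree E ∧
      (∀ e ∈ E', e.1 ∈ S ∧ e.2 ∉ S) ∧ ∃ s : ℂ, bracketMonomial E = s • bracketMonomial E' by
    obtain ⟨E', deg, cross, s, hs⟩ := this
    rw [hs]
    exact Submodule.smul_mem _ s (Submodule.subset_span ⟨E', ⟨deg, cross⟩, rfl⟩)
  induction E using Multiset.induction_on with
  | empty => exact ⟨0, rfl, by simp, 1, by simp⟩
  | cons e E ih =>
    obtain ⟨E', deg, cross, s, hs⟩ := ih fun e he => hE e (Multiset.mem_cons_of_mem he)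
    have he := hE e (Multiset.mem_cons_self e E)
    by_cases h : e.1 ∈ S
    · exact ⟨e ::ₘ E', by simp [deg], by simpa [h, ← he] using cross, s, by simp [hs]⟩
    · refine ⟨e.swap ::ₘ E', by simp [deg, add_comm], ?_, -s, ?_⟩
      · simpa [h, not_not.mp (he.not.mp h)] using cross
      · simp [hs, bracket_swap e.1 e.2]

lemma bracketMonomial_mem_bipartiteSpan [Fintype ι] {S : Finset ι} {E : Multiset (ι × ι)}
    (hE : ∑ c ∈ S, multidegree E c = ∑ c ∈ Sᶜ, multidegree E c) :
    bracketMonomial E ∈ bipartiteSpan S (multidegree E) := by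
  induction hk : E.countP (fun e => e.1 ∈ S ∧ e.2 ∈ S) using Nat.strong_induction_on
    generalizing E with
  | _ k ih =>
  have hk' := (countP_inside_eq_countP_outside hE).symm.trans hk
  obtain rfl | hpos := Nat.eq_zero_or_pos k
  · rw [Multiset.countP_eq_zero] at hk hk'
    exact bracketMonomial_mem_bipartiteSpan_of_crossing fun e he => by grind
  · obtain ⟨⟨a, b⟩, hab, ha, hb⟩ := Multiset.countP_pos.mp (hk ▸ hpos)
    obtain ⟨⟨c, d⟩, hcd, hc, hd⟩ := Multiset.countP_pos.mp (hk' ▸ hpos)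
    obtain ⟨E, rfl⟩ := Multiset.exists_cons_of_mem hab
    obtain ⟨E, rfl⟩ := Multiset.exists_cons_of_mem
      ((Multiset.mem_cons.mp hcd).resolve_left fun h => hc (congrArg Prod.fst h ▸ ha))
    simp only at ha hb hc hd
    have mem_of_crossing (u v : ι) (hu : u ∉ S) (hv : v ∉ S)
        (deg : multidegree ((a, u) ::ₘ (b, v) ::ₘ E) =
          multidegree ((a, b) ::ₘ (c, d) ::ₘ E)) :
        bracketMonomial ((a, u) ::ₘ (b, v) ::ₘ E) ∈
          bipartiteSpan S (multidegree ((a, b) ::ₘ (c, d) ::ₘ E)) := by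
      rw [← deg] at hE ⊢
      refine ih _ ?_ hE rfl
      simp [← hk, ha, hb, hu, hv, hc]
    rw [bracketMonomial_exchange]
    refine sub_mem (mem_of_crossing c d hc hd ?_) (mem_of_crossing d c hd hc ?_) <;>
      simp only [multidegree_cons] <;> abel

/-- Hall's condition: the `d * #T` edges that leave `T` end in the neighbours of `T`, each of which
receives `d` edges. -/
lemma exists_injective_mem_of_regular [Finite ι] {S : Finset ι} {E : Multiset (ι × ι)} {d : ℕ}
    (hd : d ≠ 0) (deg : multidegree E = fun _ => d) (cross : ∀ e ∈ E, e.1 ∈ S ∧ e.2 ∉ S) :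
    ∃ f : S → ι, Function.Injective f ∧ ∀ a : S, (a.1, f a) ∈ E := by
  have := Fintype.ofFinite ι
  have hall (T : Finset S) :
      T.card ≤ (T.biUnion fun a => {c : ι | (a.1, c) ∈ E}).card := by
    let N := T.biUnion fun a => {c : ι | (a.1, c) ∈ E}
    refine Nat.le_of_mul_le_mul_right ?_ (Nat.pos_of_ne_zero hd)
    calc T.card * d
      _ = ∑ c ∈ T.map (.subtype _), multidegree E c := by simp [deg]
      _ = E.countP (·.1 ∈ T.map (.subtype _)) := by
        rw [sum_multidegree, Nat.add_eq_left, Multiset.countP_eq_zero]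
        intro e he
        simp [(cross e he).2]
      _ ≤ E.countP (·.2 ∈ N) := by
        have leads_to_N : ∀ e ∈ E.filter (·.1 ∈ T.map (.subtype _)), e.2 ∈ N := by
          intro e he
          obtain ⟨he, heT⟩ := Multiset.mem_filter.mp he
          obtain ⟨a, ha, hae⟩ := Finset.mem_map.mp heT
          have : (a.1, e.2) ∈ E := by rwa [show a.1 = e.1 from hae]
          exact Finset.mem_biUnion.mpr ⟨a, ha, by simpa using this⟩
        rw [Multiset.countP_eq_card_filter, ← Multiset.countP_eq_card.mpr leads_to_N]
        exact Multiset.countP_le_of_le _ (Multiset.filter_le _ _)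
      _ ≤ ∑ c ∈ N, multidegree E c := by rw [sum_multidegree]; exact Nat.le_add_left _ _
      _ = N.card * d := by simp [deg]
  obtain ⟨f, inj, mem⟩ := (Finset.all_card_le_biUnion_card_iff_exists_injective _).mp hall
  exact ⟨f, inj, by simpa using mem⟩

end Bipartite

section Kempe

variable {ι M : Type*} [CommMonoid M] {ℓ : ℕ}

/-- A perfect matching of `ι` is encoded as a bijection `τ`, with edges from `τ (0, j)` to
`τ (1, j)`. This is the product of the values of `f` at its edges. -/
def matchingProd (f : ι → ι → M) (τ : Fin 2 × Fin ℓ ≃ ι) : M :=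
  ∏ j, f (τ (0, j)) (τ (1, j))

/-- The multiset of edges of the perfect matching encoded by `τ`. -/
def matchingEdges (τ : Fin 2 × Fin ℓ ≃ ι) : Multiset (ι × ι) :=
  Finset.univ.val.map fun j => (τ (0, j), τ (1, j))

lemma bracketMonomial_matchingEdges (τ : Fin 2 × Fin ℓ ≃ ι) :
    bracketMonomial (matchingEdges τ) = matchingProd bracket τ := by
  rw [bracketMonomial, matchingEdges, Multiset.map_map]
  rfl

lemma multidegree_matchingEdges [DecidableEq ι] (τ : Fin 2 × Fin ℓ ≃ ι) :
    multidegree (matchingEdges τ) = 1 := by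
  have := Fintype.ofEquiv _ τ
  calc multidegree (matchingEdges τ)
    _ = ∑ j, (Pi.single (τ (0, j)) 1 + Pi.single (τ (1, j)) 1) := by
      rw [multidegree, matchingEdges, Multiset.map_map]
      rfl
    _ = ∑ p, Pi.single (τ p) 1 := by
      rw [Fintype.sum_prod_type, Fin.sum_univ_two, Finset.sum_add_distrib]
    _ = ∑ c, Pi.single c 1 := τ.sum_comp fun c => Pi.single c 1
    _ = 1 := Finset.univ_sum_single 1

lemma exists_matchingEdges_le [DecidableEq ι] (τ₀ : Fin 2 × Fin ℓ ≃ ι)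
    {E : Multiset (ι × ι)} {d : ℕ} (hd : d ≠ 0) (deg : multidegree E = fun _ => d)
    (cross : ∀ e ∈ E, (τ₀.symm e.1).1 = 0 ∧ (τ₀.symm e.2).1 ≠ 0) :
    ∃ τ : Fin 2 × Fin ℓ ≃ ι, matchingEdges τ ≤ E := by
  have := Fintype.ofEquiv _ τ₀
  obtain ⟨f, inj, mem⟩ := exists_injective_mem_of_regular
    (S := {c | (τ₀.symm c).1 = 0}) hd deg (by simpa using cross)
  let a (j : Fin ℓ) : ({c | (τ₀.symm c).1 = 0} : Finset ι) := ⟨τ₀ (0, j), by simp⟩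
  let τ (p : Fin 2 × Fin ℓ) : ι := if p.1 = 0 then a p.2 else f (a p.2)
  have τ_inj : Function.Injective τ := by
    have a_inj : Function.Injective a := fun i j h => by simpa [a] using h
    have f_notMem (j : Fin ℓ) : (τ₀.symm (f (a j))).1 ≠ 0 := (cross _ (mem (a j))).2
    rintro ⟨i, j⟩ ⟨i', j'⟩ h
    fin_cases i <;> fin_cases i' <;>
      simp only [Fin.zero_eta, Fin.mk_one, one_ne_zero, if_true, if_false, τ] at h
    · simpa [a] using h
    · exact absurd (by simp [← h, a]) (f_notMem j')
    · exact absurd (by simp [h, a]) (f_notMem j)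
    · rw [a_inj (inj h)]
  refine ⟨Equiv.ofBijective τ ((Fintype.bijective_iff_injective_and_card τ).mpr
    ⟨τ_inj, Fintype.card_congr τ₀⟩), (Multiset.le_iff_subset ?_).mpr fun e he => ?_⟩
  · exact Finset.univ.nodup.map fun i j hij => by simpa [τ, a] using congrArg Prod.fst hij
  · obtain ⟨j, -, rfl⟩ := Multiset.mem_map.mp he
    exact mem (a j)

lemma bipartiteSpan_le_span_matchingProd_pow [DecidableEq ι] [Fintype ι]
    (τ₀ : Fin 2 × Fin ℓ ≃ ι) (d : ℕ) :
    bipartiteSpan {c | (τ₀.symm c).1 = 0} (fun _ => d) ≤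
      Submodule.span ℂ (Set.range fun τ : Fin 2 × Fin ℓ ≃ ι => matchingProd bracket τ) ^ d := by
  refine Submodule.span_le.mpr ?_
  rintro _ ⟨E, ⟨deg, cross⟩, rfl⟩
  induction d generalizing E with
  | zero =>
    obtain rfl | ⟨e, he⟩ := E.empty_or_exists_mem
    · exact Submodule.one_le.mp (pow_zero _).ge
    · obtain ⟨E', rfl⟩ := Multiset.exists_cons_of_mem he
      simpa using congrFun deg e.1
  | succ d ih =>
    obtain ⟨τ, hτ⟩ := exists_matchingEdges_le τ₀ d.succ_ne_zero deg (by simpa using cross)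
    obtain ⟨E', rfl⟩ := Multiset.le_iff_exists_add.mp hτ
    rw [bracketMonomial_add, bracketMonomial_matchingEdges, pow_succ']
    refine Submodule.mul_mem_mul (Submodule.subset_span ⟨τ, rfl⟩)
      (ih E' (funext fun c => ?_) fun e he => cross e (Multiset.mem_add.mpr (Or.inr he)))
    have := congrFun deg c
    rw [multidegree_add, multidegree_matchingEdges, Pi.add_apply, Pi.one_apply] at this
    lia

/-- Kempe's theorem. -/
theorem invariants_le_span_matchingProd_pow {n : ℕ} (τ₀ : Fin 2 × Fin ℓ ≃ Fin n) (d : ℕ) :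
    invariants 2 (fun _ : Fin n => d) ≤
      Submodule.span ℂ (Set.range fun τ : Fin 2 × Fin ℓ ≃ Fin n => matchingProd bracket τ) ^ d := by
  rw [invariants_eq_bracketSpan]
  refine Submodule.span_le.mpr ?_
  rintro _ ⟨E, deg, rfl⟩
  rw [Set.mem_ofPred_eq] at deg
  refine bipartiteSpan_le_span_matchingProd_pow τ₀ d ?_
  rw [← deg]
  refine bracketMonomial_mem_bipartiteSpan ?_
  rw [deg, Finset.compl_filter, Finset.sum_filter, Finset.sum_filter, ← τ₀.sum_comp,
    ← τ₀.sum_comp, Fintype.sum_prod_type, Fintype.sum_prod_type]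
  simp

end Kempe

section SegreDeterminant

variable {R : Type*} [CommRing R] {k ℓ : ℕ}

lemma segreMatrix_mul_left (g : Matrix (Fin k) (Fin k) R) (A : Matrix (Fin k) (Fin (k * ℓ)) R)
    (B : Matrix (Fin ℓ) (Fin (k * ℓ)) R) :
    segreMatrix (g * A) B = (Matrix.kronecker g (1 : Matrix (Fin ℓ) (Fin ℓ) R)).submatrix
      finProdFinEquiv.symm finProdFinEquiv.symm * segreMatrix A B := by
  ext r c
  rw [Matrix.mul_apply, ← finProdFinEquiv.sum_comp, Fintype.sum_prod_type]
  simp [-finProdFinEquiv_symm_apply, segreMatrix, Matrix.mul_apply, Matrix.one_apply,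
    Finset.sum_mul, mul_assoc]

lemma segreDet_mul_left (g : Matrix (Fin k) (Fin k) R) (A : Matrix (Fin k) (Fin (k * ℓ)) R)
    (B : Matrix (Fin ℓ) (Fin (k * ℓ)) R) :
    segreDet (g * A) B = g.det ^ ℓ * segreDet A B := by
  rw [segreDet, segreMatrix_mul_left, Matrix.det_mul, Matrix.det_submatrix_equiv_self,
    Matrix.kronecker, Matrix.det_kronecker, Matrix.det_one, one_pow, mul_one, Fintype.card_fin,
    segreDet]

lemma segreDet_mul_diagonal (A : Matrix (Fin k) (Fin (k * ℓ)) R)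
    (B : Matrix (Fin ℓ) (Fin (k * ℓ)) R) (t : Fin (k * ℓ) → R) :
    segreDet (A * Matrix.diagonal t) B = (∏ c, t c) * segreDet A B := by
  rw [segreDet, segreDet, ← Matrix.det_mul_row]
  congr 1
  ext r c
  simp only [segreMatrix, Matrix.mul_diagonal, Matrix.of_apply]
  ring

/-- For this `B`, whose column `τ (i, j)` is `e_j`, the Segre matrix is block diagonal. -/
lemma segreDet_indicator (A : Matrix (Fin k) (Fin (k * ℓ)) R)
    (τ : Fin k × Fin ℓ ≃ Fin (k * ℓ)) :
    segreDet A (Matrix.of fun j c => if (τ.symm c).2 = j then 1 else 0) =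
      Equiv.Perm.sign (finProdFinEquiv.symm.trans τ) *
        ∏ j, (A.submatrix id fun i => τ (i, j)).det := by
  set S := segreMatrix A (Matrix.of fun j c => if (τ.symm c).2 = j then 1 else 0) with hS
  have block : S.submatrix finProdFinEquiv τ =
      Matrix.blockDiagonal fun j => A.submatrix id fun i => τ (i, j) := by
    ext ⟨i, j⟩ ⟨i', j'⟩
    by_cases hj : j = j'
    · simp [-finProdFinEquiv_symm_apply, hS, segreMatrix, Matrix.blockDiagonal_apply, hj]
    · simp [-finProdFinEquiv_symm_apply, hS, segreMatrix, Matrix.blockDiagonal_apply, hj,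
        Ne.symm hj]
  have det_S : (S.submatrix finProdFinEquiv τ).det =
      Equiv.Perm.sign (finProdFinEquiv.symm.trans τ) * S.det := by
    rw [← Matrix.det_permute', ← Matrix.det_submatrix_equiv_self finProdFinEquiv]
    congr 1
    ext p q
    simp
  rw [← Matrix.det_blockDiagonal, ← block, det_S, ← mul_assoc, ← Int.cast_mul,
    Int.units_coe_mul_self, Int.cast_one, one_mul, segreDet]

lemma eval_segreForm (A : Matrix (Fin k) (Fin (k * ℓ)) ℂ) (x : Fin ℓ × Fin (k * ℓ) → ℂ) :
    eval x (segreForm A) = segreDet A (Matrix.of fun i j => x (i, j)) := by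
  rw [segreForm, segreDet, RingHom.map_det, segreDet]
  congr 1
  ext r c
  simp [segreMatrix]

lemma segreForm_mul_left (g : Matrix (Fin k) (Fin k) ℂ) (A : Matrix (Fin k) (Fin (k * ℓ)) ℂ) :
    segreForm (g * A) = g.det ^ ℓ • segreForm A :=
  MvPolynomial.funext fun x => by
    rw [smul_eval, eval_segreForm, eval_segreForm, segreDet_mul_left]

lemma segreForm_mul_diagonal (A : Matrix (Fin k) (Fin (k * ℓ)) ℂ) (t : Fin (k * ℓ) → ℂ) :
    segreForm (A * Matrix.diagonal t) = (∏ c, t c) • segreForm A :=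
  MvPolynomial.funext fun x => by
    rw [smul_eval, eval_segreForm, eval_segreForm, segreDet_mul_diagonal]

end SegreDeterminant

section SegreCoefficients

variable {k ℓ : ℕ}

/-- The coefficients of the Segre determinant, viewed as a polynomial in `B`: for a linear
functional `L` on polynomials in `B`, this is the polynomial in `A` whose value is
`L (Seg(A, B))`. It is written out by the Leibniz formula. -/
def segreCoeff (k ℓ : ℕ) : (MvPolynomial (Fin ℓ × Fin (k * ℓ)) ℂ →ₗ[ℂ] ℂ) →ₗ[ℂ]
    MvPolynomial (Fin k × Fin (k * ℓ)) ℂ where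
  toFun L := ∑ σ : Equiv.Perm (Fin (k * ℓ)),
    (Equiv.Perm.sign σ * L (∏ r, X ((finProdFinEquiv.symm (σ r)).2, r))) •
      ∏ r, X ((finProdFinEquiv.symm (σ r)).1, r)
  map_add' L L' := by
    simp only [LinearMap.add_apply, mul_add, add_smul, Finset.sum_add_distrib]
  map_smul' a L := by
    simp only [LinearMap.smul_apply, RingHom.id_apply, Finset.smul_sum, smul_smul, smul_eq_mul,
      mul_left_comm]

lemma segreForm_eq_sum (A : Matrix (Fin k) (Fin (k * ℓ)) ℂ) :
    segreForm A = ∑ σ : Equiv.Perm (Fin (k * ℓ)),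
      (Equiv.Perm.sign σ * ∏ r, A (finProdFinEquiv.symm (σ r)).1 r) •
        ∏ r, X ((finProdFinEquiv.symm (σ r)).2, r) := by
  rw [segreForm, segreDet, Matrix.det_apply]
  refine Finset.sum_congr rfl fun σ _ => ?_
  simp only [segreMatrix, Matrix.of_apply, Matrix.map_apply, Finset.prod_mul_distrib, ← map_prod,
    mul_smul, smul_eq_C_mul, Units.smul_def, zsmul_eq_mul, map_intCast]

lemma eval_segreCoeff (L : MvPolynomial (Fin ℓ × Fin (k * ℓ)) ℂ →ₗ[ℂ] ℂ)
    (A : Matrix (Fin k) (Fin (k * ℓ)) ℂ) :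
    eval (fun p => A p.1 p.2) (segreCoeff k ℓ L) = L (segreForm A) := by
  rw [segreForm_eq_sum, map_sum]
  simp only [segreCoeff, LinearMap.coe_mk, AddHom.coe_mk, map_sum, smul_eval, map_prod, eval_X,
    map_smul, smul_eq_mul, mul_right_comm]

lemma isWeightedHomogeneous_segreCoeff (L : MvPolynomial (Fin ℓ × Fin (k * ℓ)) ℂ →ₗ[ℂ] ℂ) :
    IsWeightedHomogeneous (colWeight (Fin k) (Fin (k * ℓ))) (segreCoeff k ℓ L) 1 := by
  refine Submodule.sum_mem (weightedHomogeneousSubmodule ℂ _ _) fun σ _ =>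
    Submodule.smul_mem _ _ ?_
  have prod_X := IsWeightedHomogeneous.prod (R := ℂ) (w := colWeight (Fin k) (Fin (k * ℓ)))
    Finset.univ (fun r => X ((finProdFinEquiv.symm (σ r)).1, r)) (fun r => Pi.single r 1)
    fun r _ => isWeightedHomogeneous_X _ _ _
  rwa [← Finset.univ_sum_single (1 : Fin (k * ℓ) → ℕ)]

lemma segreCoeff_mem_invariants (L : MvPolynomial (Fin ℓ × Fin (k * ℓ)) ℂ →ₗ[ℂ] ℂ) :
    segreCoeff k ℓ L ∈ invariants k 1 := by
  refine ⟨isWeightedHomogeneous_segreCoeff L, fun g => MvPolynomial.funext fun x => ?_⟩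
  let A : Matrix (Fin k) (Fin (k * ℓ)) ℂ := Matrix.of fun i c => x (i, c)
  calc eval x (leftSubst (k * ℓ) g.1 (segreCoeff k ℓ L))
    _ = L (segreForm (g.1 * A)) := (eval_leftSubst g.1 A _).trans (eval_segreCoeff L _)
    _ = L (segreForm A) := by rw [segreForm_mul_left, g.2, one_pow, one_smul]
    _ = eval x (segreCoeff k ℓ L) := (eval_segreCoeff L A).symm

end SegreCoefficients

section Matchings

variable {ℓ : ℕ}

lemma eval_matchingProd_bracket {ι : Type*} (A : Matrix (Fin 2) ι ℂ) (τ : Fin 2 × Fin ℓ ≃ ι) :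
    eval (fun p => A p.1 p.2) (matchingProd bracket τ) = matchingProd (colMinor A) τ := by
  rw [matchingProd, map_prod]
  exact Finset.prod_congr rfl fun j _ => eval_bracket A _ _

lemma matchingProd_bracket_mem_range_segreCoeff (τ : Fin 2 × Fin ℓ ≃ Fin (2 * ℓ)) :
    matchingProd bracket τ ∈ LinearMap.range (segreCoeff 2 ℓ) := by
  let B : Matrix (Fin ℓ) (Fin (2 * ℓ)) ℂ := Matrix.of fun j c => if (τ.symm c).2 = j then 1 else 0
  let s : ℂ := Equiv.Perm.sign (finProdFinEquiv.symm.trans τ)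
  have s_mul_s : s * s = 1 := by
    rw [← Int.cast_mul, Int.units_coe_mul_self, Int.cast_one]
  refine ⟨s • (aeval fun p : Fin ℓ × Fin (2 * ℓ) => B p.1 p.2).toLinearMap,
    MvPolynomial.funext fun x => ?_⟩
  let A : Matrix (Fin 2) (Fin (2 * ℓ)) ℂ := Matrix.of fun i c => x (i, c)
  calc eval x (segreCoeff 2 ℓ (s • (aeval fun p => B p.1 p.2).toLinearMap))
    _ = s * eval (fun p => B p.1 p.2) (segreForm A) := eval_segreCoeff _ A
    _ = s * segreDet A B := congrArg (s * ·) (eval_segreForm A _)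
    _ = ∏ j, (A.submatrix id fun i => τ (i, j)).det := by
      rw [segreDet_indicator, ← mul_assoc, s_mul_s, one_mul]
    _ = matchingProd (colMinor A) τ :=
      Finset.prod_congr rfl fun j _ => (colMinor_eq_det A fun i => τ (i, j)).symm
    _ = eval x (matchingProd bracket τ) := (eval_matchingProd_bracket A τ).symm

lemma invariants_le_range_segreCoeff_pow (d : ℕ) :
    invariants 2 (fun _ : Fin (2 * ℓ) => d) ≤ LinearMap.range (segreCoeff 2 ℓ) ^ d := by
  refine (invariants_le_span_matchingProd_pow finProdFinEquiv d).trans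
    (pow_le_pow_left' (Submodule.span_le.mpr ?_) d)
  rintro _ ⟨τ, rfl⟩
  exact matchingProd_bracket_mem_range_segreCoeff τ

lemma segreCoeff_mem_span_matchingProd (L : MvPolynomial (Fin ℓ × Fin (2 * ℓ)) ℂ →ₗ[ℂ] ℂ) :
    segreCoeff 2 ℓ L ∈ Submodule.span ℂ
      (Set.range fun τ : Fin 2 × Fin ℓ ≃ Fin (2 * ℓ) => matchingProd bracket τ) := by
  simpa only [pow_one] using
    invariants_le_span_matchingProd_pow finProdFinEquiv 1 (segreCoeff_mem_invariants L)

lemma segreForm_eq_smul_iff (A A' : Matrix (Fin 2) (Fin (2 * ℓ)) ℂ) (u : ℂ) :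
    segreForm A = u • segreForm A' ↔ ∀ τ : Fin 2 × Fin ℓ ≃ Fin (2 * ℓ),
      matchingProd (colMinor A) τ = u * matchingProd (colMinor A') τ := by
  constructor
  · intro h τ
    obtain ⟨L, hL⟩ := matchingProd_bracket_mem_range_segreCoeff τ
    rw [← eval_matchingProd_bracket, ← eval_matchingProd_bracket, ← hL, eval_segreCoeff,
      eval_segreCoeff, h, map_smul, smul_eq_mul]
  · intro h
    have eval_eq (f) (hf : f ∈ Submodule.span ℂ
        (Set.range fun τ : Fin 2 × Fin ℓ ≃ Fin (2 * ℓ) => matchingProd bracket τ)) :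
        eval (fun p => A p.1 p.2) f = u * eval (fun p => A' p.1 p.2) f := by
      induction hf using Submodule.span_induction with
      | mem f hf =>
        obtain ⟨τ, rfl⟩ := hf
        rw [eval_matchingProd_bracket, eval_matchingProd_bracket, h]
      | zero => simp
      | add f f' _ _ hf hf' => rw [map_add, map_add, hf, hf', mul_add]
      | smul a f _ hf => rw [smul_eval, smul_eval, hf, mul_left_comm]
    refine sub_eq_zero.mp ((Module.forall_dual_apply_eq_zero_iff ℂ _).mp fun L => ?_)
    rw [map_sub, map_smul, ← eval_segreCoeff L A, ← eval_segreCoeff L A', smul_eq_mul,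
      eval_eq _ (segreCoeff_mem_span_matchingProd L), sub_self]

end Matchings

section HomogeneousPolynomials

variable {ι K S : Type*} [CommRing K] [CommRing S] [Algebra K S]

lemma map_aeval_homogeneousSubmodule (x : ι → S) (d : ℕ) :
    (homogeneousSubmodule ι K d).map (aeval x : MvPolynomial ι K →ₐ[K] S).toLinearMap =
      Submodule.span K (Set.range x) ^ d := by
  rw [← homogeneousSubmodule_one_pow, Submodule.map_pow, homogeneousSubmodule_one_eq_span_X,
    Submodule.map_span, ← Set.range_comp]
  congr 3
  exact _root_.funext fun i => aeval_X x i

lemma aeval_mem_of_isHomogeneous {𝒜 : ℕ → Submodule K S} [SetLike.GradedMonoid 𝒜] {x : ι → S}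
    (hx : ∀ i, x i ∈ 𝒜 1) {F : MvPolynomial ι K} {d : ℕ} (hF : F.IsHomogeneous d) :
    aeval x F ∈ 𝒜 d := by
  rw [aeval_def, eval₂_eq]
  refine sum_mem fun s hs => ?_
  rw [← Algebra.smul_def, hF.degree_eq_sum_deg_support hs]
  simpa only [smul_eq_mul, mul_one] using
    Submodule.smul_mem _ _ (SetLike.prod_pow_mem_graded 𝒜 (fun _ => 1) x s fun i _ => hx i)

lemma eval_smul_of_isHomogeneous {F : MvPolynomial ι K} {d : ℕ} (hF : F.IsHomogeneous d)
    (c : K) (v : ι → K) : eval (c • v) F = c ^ d * eval v F := by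
  induction hF using IsWeightedHomogeneous.induction_on with
  | zero => simp
  | add p q _ _ hp hq => rw [map_add, map_add, hp, hq, mul_add]
  | monomial s r hs =>
    have prod_pow : (s.prod fun _ k => c ^ k) = c ^ d := by
      rw [Finsupp.prod, Finset.prod_pow_eq_pow_sum, ← hs]
      simp [Finsupp.weight_apply, Finsupp.sum]
    rw [eval_monomial, eval_monomial, ← prod_pow]
    simp only [Pi.smul_apply, smul_eq_mul, mul_pow, Finsupp.prod_mul]
    ring

end HomogeneousPolynomials

section ProjectiveVarieties

variable {N : ℕ} {S : Set (ℙ ℂ (Fin N → ℂ))} {A : Type} [CommRing A] [Algebra ℂ A]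
  {𝒜 : ℕ → Submodule ℂ A} [GradedAlgebra 𝒜] {F : MvPolynomial (Fin N) ℂ} {d : ℕ}

lemma eval_mk_rep_eq_zero_iff (hF : F.IsHomogeneous d) {v : Fin N → ℂ} (hv : v ≠ 0) :
    eval (Projectivization.mk ℂ v hv).rep F = 0 ↔ eval v F = 0 := by
  obtain ⟨a, ha⟩ := Projectivization.exists_smul_eq_mk_rep ℂ v hv
  rw [← ha, Units.smul_def, eval_smul_of_isHomogeneous hF, mul_eq_zero,
    or_iff_right (pow_ne_zero _ a.ne_zero)]

lemma forall_mem_zariskiClosure_iff (hF : F.IsHomogeneous d) :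
    (∀ q ∈ zariskiClosure S, eval q.rep F = 0) ↔ ∀ q ∈ S, eval q.rep F = 0 :=
  ⟨fun h q hq => h q fun _ _ _ hG => hG q hq, fun h _ hq => hq d F hF h⟩

lemma map_homogeneousComponent_eq_zero {φ : MvPolynomial (Fin N) ℂ →ₐ[ℂ] A}
    (hφ : ∀ d, (homogeneousSubmodule (Fin N) ℂ d).map φ.toLinearMap = 𝒜 d) (hF : φ F = 0) :
    φ (homogeneousComponent d F) = 0 := by
  let _ : GradedAlgebra (homogeneousSubmodule (Fin N) ℂ) := MvPolynomial.gradedAlgebra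
  let ψ : homogeneousSubmodule (Fin N) ℂ →+*ᵍ 𝒜 :=
    ⟨φ.toRingHom, fun {d F} hF => hφ d ▸ ⟨F, hF, rfl⟩⟩
  calc φ (homogeneousComponent d F)
    _ = ψ (DirectSum.decompose (homogeneousSubmodule (Fin N) ℂ) F d) :=
      congrArg φ (decomposition.decompose'_apply F d).symm
    _ = DirectSum.decompose 𝒜 (φ F) d := ψ.map_directSumDecompose
    _ = 0 := by rw [hF, DirectSum.decompose_zero]; rfl

lemma vanishingIdeal_eq_ker {φ : MvPolynomial (Fin N) ℂ →ₐ[ℂ] A}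
    (hφ : ∀ d, (homogeneousSubmodule (Fin N) ℂ d).map φ.toLinearMap = 𝒜 d)
    (vanish : ∀ (d : ℕ) (F : MvPolynomial (Fin N) ℂ), F.IsHomogeneous d →
      ((∀ q ∈ S, eval q.rep F = 0) ↔ φ F = 0)) :
    vanishingIdeal S = RingHom.ker φ := by
  refine le_antisymm (Ideal.span_le.mpr ?_) fun F hF => ?_
  · rintro F ⟨⟨d, hd⟩, hF⟩
    exact (vanish d F hd).mp hF
  · rw [← sum_homogeneousComponent F]
    refine sum_mem fun d _ => Ideal.subset_span ?_
    have hom := homogeneousComponent_isHomogeneous d F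
    exact ⟨⟨d, hom⟩, (vanish d _ hom).mpr (map_homogeneousComponent_eq_zero hφ hF)⟩

theorem nonempty_projVariety_iso (φ : MvPolynomial (Fin N) ℂ →ₐ[ℂ] A)
    (hφ : ∀ d, (homogeneousSubmodule (Fin N) ℂ d).map φ.toLinearMap = 𝒜 d)
    (vanish : ∀ (d : ℕ) (F : MvPolynomial (Fin N) ℂ), F.IsHomogeneous d →
      ((∀ q ∈ S, eval q.rep F = 0) ↔ φ F = 0)) :
    Nonempty (projVariety S ≅ projOver 𝒜) := by
  have surj : Function.Surjective φ := by
    classical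
    intro a
    change a ∈ φ.range
    rw [← DirectSum.sum_support_decompose 𝒜 a]
    refine sum_mem fun d _ => ?_
    obtain ⟨F, -, hF⟩ := (hφ d).ge (DirectSum.decompose 𝒜 a d).2
    exact ⟨F, hF⟩
  let f : CoordRing S ≃ₐ[ℂ] A :=
    (Ideal.quotientEquivAlgOfEq ℂ (vanishingIdeal_eq_ker hφ vanish)).trans
      (Ideal.quotientKerAlgEquivOfSurjective surj)
  refine nonempty_projOver_iso f fun d => ?_
  rw [coordGrading, ← Submodule.map_comp, ← hφ d]
  rfl

end ProjectiveVarieties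

section Grassmannian

variable {k n : ℕ}

lemma exists_eq_mul_matrix_of_mem (W : Gr k n) {A : Matrix (Fin k) (Fin n) ℂ}
    (hA : ∀ i, A i ∈ W.1) : ∃ g : Matrix (Fin k) (Fin k) ℂ, A = g * W.matrix := by
  let b := Module.finBasisOfFinrankEq ℂ W.1 W.2
  refine ⟨Matrix.of fun i j => b.repr ⟨A i, hA i⟩ j, ?_⟩
  ext i c
  calc A i c
    _ = (∑ j, b.repr ⟨A i, hA i⟩ j • b j : W.1).1 c := by rw [b.sum_repr]
    _ = ∑ j, b.repr ⟨A i, hA i⟩ j * (b j).1 c := by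
      simp only [Submodule.coe_sum, Submodule.coe_smul, Finset.sum_apply, Pi.smul_apply,
        smul_eq_mul]

lemma exists_eq_mul_matrix {A : Matrix (Fin k) (Fin n) ℂ} (hA : LinearIndependent ℂ A.row) :
    ∃ (W : Gr k n) (g : Matrix (Fin k) (Fin k) ℂ), A = g * W.matrix :=
  let W : Gr k n :=
    ⟨Submodule.span ℂ (Set.range A.row), by rw [finrank_span_eq_card hA, Fintype.card_fin]⟩
  ⟨W, exists_eq_mul_matrix_of_mem W fun i => Submodule.subset_span ⟨i, rfl⟩⟩

lemma exists_isUniform_eq_mul_matrix (hkn : k ≤ n) {A : Matrix (Fin k) (Fin n) ℂ}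
    (hA : ∀ I : Fin k ↪o Fin n, (A.submatrix id I).det ≠ 0) :
    ∃ (W : Gr k n) (g : Matrix (Fin k) (Fin k) ℂ), W.IsUniform ∧ A = g * W.matrix := by
  have indep : LinearIndependent ℂ A.row :=
    (Matrix.linearIndependent_rows_of_det_ne_zero (hA (Fin.castLEOrderEmb hkn))).of_comp
      (LinearMap.funLeft ℂ ℂ (Fin.castLEOrderEmb hkn))
  obtain ⟨W, g, rfl⟩ := exists_eq_mul_matrix indep
  refine ⟨W, g, fun I hI => hA I ?_, rfl⟩
  rw [Matrix.submatrix_mul _ _ _ id _ Function.bijective_id, Matrix.det_mul]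
  exact mul_eq_zero_of_right _ hI

lemma det_mvPolynomialX_submatrix_ne_zero (I : Fin k ↪o Fin n) :
    ((Matrix.mvPolynomialX (Fin k) (Fin n) ℂ).submatrix id I).det ≠ 0 := by
  have : (Matrix.mvPolynomialX (Fin k) (Fin n) ℂ).submatrix id I =
      (rename (R := ℂ) (Prod.map id I)).mapMatrix (Matrix.mvPolynomialX (Fin k) (Fin k) ℂ) := by
    ext i j : 1
    simp
  rw [this, ← AlgHom.map_det]
  exact (map_ne_zero_iff _ (rename_injective _ (Function.injective_id.prodMap I.injective))).mpr
    (Matrix.det_mvPolynomialX_ne_zero (Fin k) ℂ)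

lemma eq_zero_of_eval_eq_zero_of_minors_ne_zero {f : MvPolynomial (Fin k × Fin n) ℂ}
    (hf : ∀ A : Matrix (Fin k) (Fin n) ℂ, (∀ I : Fin k ↪o Fin n, (A.submatrix id I).det ≠ 0) →
      eval (fun p => A p.1 p.2) f = 0) : f = 0 := by
  let m (I : Fin k ↪o Fin n) := ((Matrix.mvPolynomialX (Fin k) (Fin n) ℂ).submatrix id I).det
  refine (mul_eq_zero.mp (?_ : f * ∏ I, m I = 0)).resolve_right
    (Finset.prod_ne_zero_iff.mpr fun I _ => det_mvPolynomialX_submatrix_ne_zero I)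
  refine MvPolynomial.funext fun x => ?_
  let A : Matrix (Fin k) (Fin n) ℂ := Matrix.of fun i c => x (i, c)
  have eval_m (I) : eval x (m I) = (A.submatrix id I).det := by
    rw [RingHom.map_det]
    congr 1
    ext i j
    simp [A]
  simp only [map_mul, map_prod, eval_m, map_zero, mul_eq_zero, Finset.prod_eq_zero_iff]
  by_cases hA : ∀ I : Fin k ↪o Fin n, (A.submatrix id I).det ≠ 0
  · exact .inl (hf A hA)
  · push Not at hA
    exact .inr (hA.imp fun I hI => ⟨Finset.mem_univ I, hI⟩)

end Grassmannian

section SegreCoordinates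

variable {k ℓ N : ℕ} (e : Module.Basis (Fin N) ℂ (grSections ℓ (k * ℓ) k))

/-- The homogeneous coordinates of the Segre form of `A`. -/
def segreCoords (A : Matrix (Fin k) (Fin (k * ℓ)) ℂ) : Fin N → ℂ :=
  e.equivFun ⟨segreForm A, segreForm_mem A⟩

lemma segreCoords_mul_left (g : Matrix (Fin k) (Fin k) ℂ) (A : Matrix (Fin k) (Fin (k * ℓ)) ℂ) :
    segreCoords e (g * A) = g.det ^ ℓ • segreCoords e A := by
  rw [segreCoords, segreCoords, ← map_smul]
  exact congrArg _ (Subtype.ext (segreForm_mul_left g A))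

/-- The `i`-th homogeneous coordinate of the Segre form of `A`, as a polynomial in `A`. -/
def coordPoly (i : Fin N) : MvPolynomial (Fin k × Fin (k * ℓ)) ℂ :=
  segreCoeff k ℓ (e.coord i).exists_extend.choose

lemma eval_coordPoly (A : Matrix (Fin k) (Fin (k * ℓ)) ℂ) (i : Fin N) :
    eval (fun p => A p.1 p.2) (coordPoly e i) = segreCoords e A i :=
  (eval_segreCoeff _ A).trans
    (DFunLike.congr_fun (e.coord i).exists_extend.choose_spec ⟨segreForm A, segreForm_mem A⟩)

lemma coordPoly_mem_invariants (i : Fin N) : coordPoly e i ∈ invariants k 1 :=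
  segreCoeff_mem_invariants _

lemma segreCoeff_eq_sum_coordPoly (L : MvPolynomial (Fin ℓ × Fin (k * ℓ)) ℂ →ₗ[ℂ] ℂ) :
    segreCoeff k ℓ L = ∑ i, L (e i) • coordPoly e i := by
  refine MvPolynomial.funext fun x => ?_
  let A : Matrix (Fin k) (Fin (k * ℓ)) ℂ := Matrix.of fun i c => x (i, c)
  calc eval x (segreCoeff k ℓ L)
    _ = L (segreForm A) := eval_segreCoeff L A
    _ = L (∑ i, segreCoords e A i • e i : grSections ℓ (k * ℓ) k) := by
      rw [segreCoords, e.sum_equivFun]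
    _ = ∑ i, L (e i) * segreCoords e A i := by
      simp only [Submodule.coe_sum, Submodule.coe_smul, map_sum, map_smul, smul_eq_mul, mul_comm]
    _ = eval x (∑ i, L (e i) • coordPoly e i) := by
      rw [map_sum]
      exact Finset.sum_congr rfl fun i _ => by
        rw [smul_eval, ← eval_coordPoly]
        rfl

lemma range_segreCoeff_le_span_coordPoly :
    LinearMap.range (segreCoeff k ℓ) ≤ Submodule.span ℂ (Set.range (coordPoly e)) := by
  rintro _ ⟨L, rfl⟩
  rw [segreCoeff_eq_sum_coordPoly e]
  exact sum_mem fun i _ => Submodule.smul_mem _ _ (Submodule.subset_span ⟨i, rfl⟩)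

/-- The pullback of homogeneous coordinates along the Segre coefficient map. -/
def segrePullback : MvPolynomial (Fin N) ℂ →ₐ[ℂ] MvPolynomial (Fin k × Fin (k * ℓ)) ℂ :=
  aeval (coordPoly e)

lemma eval_segrePullback (F : MvPolynomial (Fin N) ℂ) (A : Matrix (Fin k) (Fin (k * ℓ)) ℂ) :
    eval (fun p => A p.1 p.2) (segrePullback e F) = eval (segreCoords e A) F := by
  rw [segrePullback, ← _root_.funext (eval_coordPoly e A)]
  induction F using MvPolynomial.induction_on <;> simp_all

variable {e} {F : MvPolynomial (Fin N) ℂ} {d : ℕ}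

lemma forall_mem_coeffVariety_iff (hF : F.IsHomogeneous d) :
    (∀ q ∈ coeffVariety e, eval q.rep F = 0) ↔
      ∀ W : Gr k (k * ℓ), W.IsUniform → eval (segreCoords e W.matrix) F = 0 := by
  have eval_segreMap (W : Gr k (k * ℓ)) (hW : W.IsUniform) :
      eval (Projectivization.map e.equivFun.toLinearMap e.equivFun.injective
        (segreMap W hW)).rep F = 0 ↔ eval (segreCoords e W.matrix) F = 0 := by
    rw [segreMap, Projectivization.map_mk]
    exact eval_mk_rep_eq_zero_iff hF _
  rw [coeffVariety, forall_mem_zariskiClosure_iff hF]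
  constructor
  · exact fun h W hW => (eval_segreMap W hW).mp (h _ ⟨W, hW, rfl⟩)
  · rintro h _ ⟨W, hW, rfl⟩
    exact (eval_segreMap W hW).mpr (h W hW)

lemma forall_mem_coeffVariety_iff_segrePullback_eq_zero (hℓ : 1 ≤ ℓ) (hF : F.IsHomogeneous d) :
    (∀ q ∈ coeffVariety e, eval q.rep F = 0) ↔ segrePullback e F = 0 := by
  rw [forall_mem_coeffVariety_iff hF]
  refine ⟨fun h => eq_zero_of_eval_eq_zero_of_minors_ne_zero fun A hA => ?_,
    fun h W _ => by rw [← eval_segrePullback, h, map_zero]⟩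
  obtain ⟨W, g, hW, rfl⟩ := exists_isUniform_eq_mul_matrix (Nat.le_mul_of_pos_right k hℓ) hA
  rw [eval_segrePullback, segreCoords_mul_left, eval_smul_of_isHomogeneous hF, h W hW, mul_zero]

end SegreCoordinates

section InvariantRing

/-- The ring of invariants of `n` points on the line, mapped to the polynomials in their
homogeneous coordinates. -/
def gitToPoly (n : ℕ) : GitRing n →ₐ[ℂ] MvPolynomial (Fin 2 × Fin n) ℂ :=
  DirectSum.coeAlgHom (gitInvariants n)

lemma gitToPoly_gitOf (n d : ℕ) (f : gitInvariants n d) : gitToPoly n (gitOf n d f) = f :=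
  DirectSum.coeAlgHom_of _ _ _

variable {ℓ N : ℕ} (e : Module.Basis (Fin N) ℂ (grSections ℓ (2 * ℓ) 2))

/-- The map from homogeneous coordinates to the ring of invariants induced by `segrePullback`. -/
def toGitRing : MvPolynomial (Fin N) ℂ →ₐ[ℂ] GitRing (2 * ℓ) :=
  aeval fun i => gitOf (2 * ℓ) 1 ⟨coordPoly e i, coordPoly_mem_invariants e i⟩

lemma gitToPoly_toGitRing (F : MvPolynomial (Fin N) ℂ) :
    gitToPoly (2 * ℓ) (toGitRing e F) = segrePullback e F := by
  suffices (gitToPoly (2 * ℓ)).comp (toGitRing e) = segrePullback e from DFunLike.congr_fun this F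
  exact MvPolynomial.algHom_ext fun i => by simp [toGitRing, segrePullback, gitToPoly_gitOf]

lemma exists_toGitRing_eq_gitOf {F : MvPolynomial (Fin N) ℂ} {d : ℕ} (hF : F.IsHomogeneous d) :
    ∃ f : gitInvariants (2 * ℓ) d, toGitRing e F = gitOf (2 * ℓ) d f ∧ f = segrePullback e F := by
  obtain ⟨f, hf⟩ : toGitRing e F ∈ gitGrading (2 * ℓ) d :=
    aeval_mem_of_isHomogeneous (𝒜 := gitGrading (2 * ℓ)) (fun _ => ⟨_, rfl⟩) hF
  exact ⟨f, hf.symm, by rw [← gitToPoly_toGitRing, ← hf, gitToPoly_gitOf]⟩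

lemma toGitRing_eq_zero_iff {F : MvPolynomial (Fin N) ℂ} {d : ℕ} (hF : F.IsHomogeneous d) :
    toGitRing e F = 0 ↔ segrePullback e F = 0 := by
  obtain ⟨f, hf, hf'⟩ := exists_toGitRing_eq_gitOf e hF
  refine ⟨fun h => by rw [← gitToPoly_toGitRing, h, map_zero], fun h => ?_⟩
  rw [hf, Subtype.ext (hf'.trans h : f.1 = (0 : gitInvariants (2 * ℓ) d)), map_zero]

lemma map_toGitRing_homogeneousSubmodule (d : ℕ) :
    (homogeneousSubmodule (Fin N) ℂ d).map (toGitRing e).toLinearMap = gitGrading (2 * ℓ) d := by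
  refine le_antisymm ?_ ?_
  · rintro _ ⟨F, hF, rfl⟩
    obtain ⟨f, hf, -⟩ := exists_toGitRing_eq_gitOf e hF
    exact ⟨f, hf.symm⟩
  · rintro _ ⟨f, rfl⟩
    have le : invariants 2 (fun _ : Fin (2 * ℓ) => d) ≤
        (homogeneousSubmodule (Fin N) ℂ d).map (segrePullback e).toLinearMap := by
      rw [segrePullback, map_aeval_homogeneousSubmodule]
      exact (invariants_le_range_segreCoeff_pow d).trans
        (pow_le_pow_left' (range_segreCoeff_le_span_coordPoly e) d)
    obtain ⟨F, hF, hFf⟩ := le f.2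
    obtain ⟨f', hf', hFf'⟩ := exists_toGitRing_eq_gitOf e hF
    exact ⟨F, hF, hf'.trans (congrArg _ (Subtype.ext (hFf'.trans hFf)))⟩

theorem nonempty_coeffVariety_iso_gitQuotient (hℓ : 1 ≤ ℓ) :
    Nonempty (projVariety (coeffVariety e) ≅ gitQuotient (2 * ℓ)) :=
  nonempty_projVariety_iso (toGitRing e) (map_toGitRing_homogeneousSubmodule e) fun _ _ hF => by
    rw [forall_mem_coeffVariety_iff_segrePullback_eq_zero hℓ hF, toGitRing_eq_zero_iff e hF]

end InvariantRing

section CrossRatios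

variable {K ι : Type*} [Field K]

lemma exists_eq_mul_of_colMinor_proportional {A B : Matrix (Fin 2) ι K} {p q : ι}
    (hA : colMinor A p q ≠ 0) (hB : colMinor B p q ≠ 0)
    (left : ∀ c, colMinor B p c * colMinor A p q = colMinor B p q * colMinor A p c)
    (right : ∀ c, colMinor B c q * colMinor A p q = colMinor B p q * colMinor A c q) :
    ∃ g : Matrix (Fin 2) (Fin 2) K, B = g * A := by
  let cols (M : Matrix (Fin 2) ι K) : Matrix (Fin 2) (Fin 2) K := M.submatrix id ![p, q]
  let coords : Matrix (Fin 2) ι K :=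
    Matrix.of ![fun c => colMinor A c q / colMinor A p q, fun c => colMinor A p c / colMinor A p q]
  have eq_cols_mul {M : Matrix (Fin 2) ι K} (hM : colMinor M p q ≠ 0)
      (left : ∀ c, colMinor M p c * colMinor A p q = colMinor M p q * colMinor A p c)
      (right : ∀ c, colMinor M c q * colMinor A p q = colMinor M p q * colMinor A c q) :
      M = cols M * coords := by
    ext i c
    have coords_left : coords 0 c = colMinor M c q / colMinor M p q :=
      (div_eq_div_iff hA hM).mpr (by rw [right, mul_comm])
    have coords_right : coords 1 c = colMinor M p c / colMinor M p q :=
      (div_eq_div_iff hA hM).mpr (by rw [left, mul_comm])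
    rw [Matrix.mul_apply, Fin.sum_univ_two, coords_left, coords_right, mul_div_assoc',
      mul_div_assoc', ← add_div, eq_div_iff hM, mul_comm, colMinor_mul_apply, mul_comm,
      mul_comm (colMinor M p c)]
    rfl
  have det_cols : IsUnit (cols A).det := by
    rw [← colMinor_eq_det]
    exact hA.isUnit
  refine ⟨cols B * (cols A)⁻¹, ?_⟩
  calc B
    _ = cols B * ((cols A)⁻¹ * cols A) * coords := by
      rw [Matrix.nonsing_inv_mul _ det_cols, mul_one, ← eq_cols_mul hB left right]
    _ = cols B * (cols A)⁻¹ * A := by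
      rw [← mul_assoc, Matrix.mul_assoc _ (cols A),
        ← eq_cols_mul hA (fun _ => mul_comm _ _) fun _ => mul_comm _ _]

variable {A A' : Matrix (Fin 2) ι K}

lemma exists_forall_mul_colMinor_eq (hA : Pairwise fun a b => colMinor A a b ≠ 0)
    (hA' : Pairwise fun a b => colMinor A' a b ≠ 0)
    (cross : ∀ a b c d, [a, b, c, d].Nodup →
      colMinor A a c * colMinor A b d * (colMinor A' a d * colMinor A' b c) =
        colMinor A a d * colMinor A b c * (colMinor A' a c * colMinor A' b d))
    {p q : ι} (hpq : p ≠ q) :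
    ∃ r ≠ 0, ∀ c ≠ p,
      r * (colMinor A c q * colMinor A' p c) = colMinor A p c * colMinor A' c q := by
  by_cases third : ∃ c₀, p ≠ c₀ ∧ q ≠ c₀
  · obtain ⟨c₀, hp, hq⟩ := third
    have denom_ne_zero : colMinor A c₀ q * colMinor A' p c₀ ≠ 0 := mul_ne_zero (hA hq.symm) (hA' hp)
    refine ⟨colMinor A p c₀ * colMinor A' c₀ q / (colMinor A c₀ q * colMinor A' p c₀),
      div_ne_zero (mul_ne_zero (hA hp) (hA' hq.symm)) denom_ne_zero, fun c hc => ?_⟩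
    rw [div_mul_eq_mul_div, div_eq_iff denom_ne_zero]
    obtain rfl | hcq := eq_or_ne c q
    · simp [colMinor]
    obtain rfl | hcc := eq_or_ne c c₀
    · ring
    have := cross p q c₀ c (by simp [hpq, hp, hq, hc.symm, hcq.symm, hcc.symm])
    rw [colMinor_swap A c q, colMinor_swap A c₀ q, colMinor_swap A' c q,
      colMinor_swap A' c₀ q] at this
    linear_combination this
  · refine ⟨1, one_ne_zero, fun c hc => ?_⟩
    obtain rfl : q = c := by_contra fun hq => third ⟨c, hc.symm, hq⟩
    simp [colMinor]

lemma exists_mul_diagonal_eq_mul_of_crossRatio_eq [Fintype ι] [DecidableEq ι] [Nontrivial ι]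
    (hA : Pairwise fun a b => colMinor A a b ≠ 0) (hA' : Pairwise fun a b => colMinor A' a b ≠ 0)
    (cross : ∀ a b c d, [a, b, c, d].Nodup →
      colMinor A a c * colMinor A b d * (colMinor A' a d * colMinor A' b c) =
        colMinor A a d * colMinor A b c * (colMinor A' a c * colMinor A' b d)) :
    ∃ (t : ι → Kˣ) (g : Matrix (Fin 2) (Fin 2) K),
      A' * Matrix.diagonal (fun c => (t c : K)) = g * A := by
  obtain ⟨p, q, hpq⟩ := exists_pair_ne ι
  obtain ⟨r, hr, scale⟩ := exists_forall_mul_colMinor_eq hA hA' cross hpq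
  let t : ι → K := Function.update (fun c => colMinor A p c / colMinor A' p c) p
    (r * colMinor A p q / colMinor A' p q)
  have t_of_ne {c : ι} (hc : c ≠ p) : t c * colMinor A' p c = colMinor A p c := by
    rw [show t c = _ from Function.update_of_ne hc _ _, div_mul_cancel₀ _ (hA' hc.symm)]
  have t_self : t p * colMinor A' p q = r * colMinor A p q := by
    rw [show t p = _ from Function.update_self .., div_mul_cancel₀ _ (hA' hpq)]
  have t_ne_zero (c : ι) : t c ≠ 0 := by
    obtain rfl | hc := eq_or_ne c p
    · exact left_ne_zero_of_mul (t_self.trans_ne (mul_ne_zero hr (hA hpq)))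
    · exact left_ne_zero_of_mul ((t_of_ne hc).trans_ne (hA hc.symm))
  refine ⟨fun c => Units.mk0 (t c) (t_ne_zero c), exists_eq_mul_of_colMinor_proportional
    (hA hpq) ?_ (fun c => ?_) fun c => ?_⟩ <;>
    simp only [Units.val_mk0, colMinor_mul_diagonal]
  · exact mul_ne_zero (mul_ne_zero (t_ne_zero p) (t_ne_zero q)) (hA' hpq)
  · obtain rfl | hc := eq_or_ne c p
    · simp [colMinor]
    · linear_combination t p * colMinor A p q * t_of_ne hc - t p * colMinor A p c * t_of_ne hpq.symm
  · obtain rfl | hc := eq_or_ne c p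
    · rfl
    · refine mul_right_cancel₀ (hA' hc.symm) ?_
      linear_combination t q * colMinor A' c q * colMinor A p q * t_of_ne hc
        - t q * colMinor A p q * scale c hc - t q * colMinor A c q * colMinor A' p c * t_self

end CrossRatios

section Exchange

variable {ι M : Type*} [CommMonoid M] {ℓ : ℕ}

lemma exists_equiv_apply_eq {α β : Type*} [Finite α] (τ₀ : β ≃ α) {k : ℕ} (x : Fin k ↪ β)
    (y : Fin k ↪ α) : ∃ τ : β ≃ α, ∀ i, τ (x i) = y i := by
  have := Equiv.Perm.isMultiplyPretransitive α k
  obtain ⟨ρ, hρ⟩ := MulAction.exists_smul_eq (Equiv.Perm α) (x.trans τ₀.toEmbedding) y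
  exact ⟨τ₀.trans ρ, fun i => DFunLike.congr_fun hρ i⟩

lemma exists_equiv_of_nodup [Finite ι] (τ₀ : Fin 2 × Fin ℓ ≃ ι) {j₀ j₁ : Fin ℓ} (hj : j₀ ≠ j₁)
    {a b c d : ι} (nodup : [a, b, c, d].Nodup) : ∃ τ : Fin 2 × Fin ℓ ≃ ι,
      τ (0, j₀) = a ∧ τ (0, j₁) = b ∧ τ (1, j₀) = c ∧ τ (1, j₁) = d := by
  have nodup' : [((0 : Fin 2), j₀), (0, j₁), (1, j₀), (1, j₁)].Nodup := by simp [hj]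
  obtain ⟨τ, hτ⟩ := exists_equiv_apply_eq τ₀ ⟨_, List.nodup_iff_injective_get.mp nodup'⟩
    ⟨_, List.nodup_iff_injective_get.mp nodup⟩
  exact ⟨τ, hτ 0, hτ 1, hτ 2, hτ 3⟩

lemma matchingProd_eq_mul_mul_prod (f : ι → ι → M) (τ : Fin 2 × Fin ℓ ≃ ι) {j₀ j₁ : Fin ℓ}
    (hj : j₀ ≠ j₁) : matchingProd f τ = f (τ (0, j₀)) (τ (1, j₀)) * f (τ (0, j₁)) (τ (1, j₁)) *
      ∏ j ∈ {j₀, j₁}ᶜ, f (τ (0, j)) (τ (1, j)) := by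
  rw [matchingProd, ← Finset.prod_mul_prod_compl {j₀, j₁}, Finset.prod_pair hj]

lemma matchingProd_swap_trans (f : ι → ι → M) (τ : Fin 2 × Fin ℓ ≃ ι) {j₀ j₁ : Fin ℓ}
    (hj : j₀ ≠ j₁) :
    matchingProd f ((Equiv.swap (1, j₀) (1, j₁)).trans τ) =
      f (τ (0, j₀)) (τ (1, j₁)) * f (τ (0, j₁)) (τ (1, j₀)) *
        ∏ j ∈ {j₀, j₁}ᶜ, f (τ (0, j)) (τ (1, j)) := by
  have swap_zero (j : Fin ℓ) : Equiv.swap (1, j₀) (1, j₁) ((0 : Fin 2), j) = (0, j) :=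
    Equiv.swap_apply_of_ne_of_ne (by simp) (by simp)
  rw [matchingProd_eq_mul_mul_prod _ _ hj]
  simp only [Equiv.trans_apply, swap_zero, Equiv.swap_apply_left, Equiv.swap_apply_right]
  congr 1
  refine Finset.prod_congr rfl fun j h => ?_
  rw [Finset.mem_compl, Finset.mem_insert, Finset.mem_singleton, not_or] at h
  rw [Equiv.swap_apply_of_ne_of_ne (by simp [h.1]) (by simp [h.2])]

lemma exists_matchingProd_exchange [Finite ι] (τ₀ : Fin 2 × Fin ℓ ≃ ι) {a b c d : ι}
    (nodup : [a, b, c, d].Nodup) : ∃ τ τ' : Fin 2 × Fin ℓ ≃ ι, ∀ f : ι → ι → M,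
      matchingProd f τ * (f a d * f b c) = matchingProd f τ' * (f a c * f b d) := by
  have := Fintype.ofEquiv _ τ₀
  have card_ge : 4 ≤ 2 * ℓ := by
    simpa [← Fintype.card_congr τ₀] using nodup.length_le_card
  let j₀ : Fin ℓ := ⟨0, by lia⟩
  let j₁ : Fin ℓ := ⟨1, by lia⟩
  have hj : j₀ ≠ j₁ := by simp [j₀, j₁]
  obtain ⟨τ, rfl, rfl, rfl, rfl⟩ := exists_equiv_of_nodup τ₀ hj nodup
  refine ⟨τ, (Equiv.swap (1, j₀) (1, j₁)).trans τ, fun f => ?_⟩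
  rw [matchingProd_eq_mul_mul_prod f τ hj, matchingProd_swap_trans f τ hj, mul_right_comm,
    mul_comm (f _ _ * f _ _), mul_right_comm]

lemma matchingProd_ne_zero {K : Type*} [Field K] {f : ι → ι → K}
    (hf : Pairwise fun a b => f a b ≠ 0) (τ : Fin 2 × Fin ℓ ≃ ι) : matchingProd f τ ≠ 0 :=
  Finset.prod_ne_zero_iff.mpr fun j _ => hf (τ.injective.ne (by simp))

lemma crossRatio_eq_of_matchingProd_proportional {K : Type*} [Field K] [Finite ι]
    (τ₀ : Fin 2 × Fin ℓ ≃ ι) {f f' : ι → ι → K} (hf : Pairwise fun a b => f a b ≠ 0)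
    (hf' : Pairwise fun a b => f' a b ≠ 0) {u : K}
    (prop : ∀ τ : Fin 2 × Fin ℓ ≃ ι, matchingProd f τ = u * matchingProd f' τ)
    {a b c d : ι} (nodup : [a, b, c, d].Nodup) :
    f a c * f b d * (f' a d * f' b c) = f a d * f b c * (f' a c * f' b d) := by
  obtain ⟨τ, τ', exchange⟩ := exists_matchingProd_exchange (M := K) τ₀ nodup
  refine mul_left_cancel₀ (mul_ne_zero (matchingProd_ne_zero hf τ')
    (matchingProd_ne_zero hf' τ)) ?_
  have cross : matchingProd f τ * matchingProd f' τ' = matchingProd f τ' * matchingProd f' τ := by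
    rw [prop, prop]; ring
  calc matchingProd f τ' * matchingProd f' τ * (f a c * f b d * (f' a d * f' b c))
    _ = (matchingProd f τ' * (f a c * f b d)) * (matchingProd f' τ * (f' a d * f' b c)) := by ring
    _ = (matchingProd f τ * matchingProd f' τ') * ((f a d * f b c) * (f' a c * f' b d)) := by
      rw [← exchange f, exchange f']; ring
    _ = matchingProd f τ' * matchingProd f' τ * (f a d * f b c * (f' a c * f' b d)) := by
      rw [cross, mul_assoc]

end Exchange

section TorusOrbits

variable {k n ℓ : ℕ}

lemma Gr.matrix_mem (W : Gr k n) (i : Fin k) : W.matrix i ∈ W.1 :=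
  (Module.finBasisOfFinrankEq ℂ W.1 W.2 i).2

lemma Gr.span_range_matrix (W : Gr k n) : Submodule.span ℂ (Set.range W.matrix) = W.1 := by
  have span_eq := congrArg (Submodule.map W.1.subtype)
    (Module.finBasisOfFinrankEq ℂ W.1 W.2).span_eq
  rwa [Submodule.map_span, ← Set.range_comp, Submodule.map_subtype_top] at span_eq

lemma Gr.eq_of_matrix_eq_mul {W W' : Gr k n} {g : Matrix (Fin k) (Fin k) ℂ}
    (h : W.matrix = g * W'.matrix) : W = W' := by
  refine Subtype.ext (Submodule.eq_of_le_of_finrank_eq ?_ (W.2.trans W'.2.symm))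
  rw [← W.span_range_matrix, Submodule.span_le]
  rintro _ ⟨i, rfl⟩
  have row_eq : W.matrix i = ∑ j, g i j • W'.matrix j := by
    rw [h]
    ext c
    rw [Matrix.mul_apply, Finset.sum_apply]
    rfl
  exact row_eq ▸ sum_mem fun j _ => Submodule.smul_mem _ _ (W'.matrix_mem j)

lemma Gr.mem_torusAct {t : Fin n → ℂˣ} {W : Gr k n} {v : Fin n → ℂ} :
    v ∈ (W.torusAct t).1 ↔ ∃ w ∈ W.1, (fun c => (t c : ℂ) * w c) = v := Iff.rfl

lemma Gr.torusAct_torusAct (s t : Fin n → ℂˣ) (W : Gr k n) :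
    (W.torusAct t).torusAct s = W.torusAct (s * t) := by
  refine Subtype.ext (Submodule.ext fun v => ?_)
  simp only [Gr.mem_torusAct, exists_exists_and_eq_and, Pi.mul_apply, Units.val_mul, mul_assoc]

lemma Gr.one_torusAct (W : Gr k n) : W.torusAct 1 = W :=
  Subtype.ext (Submodule.ext fun v => by simp [Gr.mem_torusAct])

lemma Gr.mem_orbitClosure_self (W : Gr k n) : W ∈ W.orbitClosure := fun _ _ _ vanish => by
  simpa only [Gr.one_torusAct] using vanish 1

lemma Gr.orbitClosure_torusAct_subset (t : Fin n → ℂˣ) (W : Gr k n) :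
    (W.torusAct t).orbitClosure ⊆ W.orbitClosure := fun _ hU d F hF vanish =>
  hU d F hF fun s => by rw [Gr.torusAct_torusAct]; exact vanish (s * t)

lemma Gr.orbitClosure_torusAct (t : Fin n → ℂˣ) (W : Gr k n) :
    (W.torusAct t).orbitClosure = W.orbitClosure := by
  refine (orbitClosure_torusAct_subset t W).antisymm ?_
  simpa only [torusAct_torusAct, inv_mul_cancel, one_torusAct] using
    orbitClosure_torusAct_subset t⁻¹ (W.torusAct t)

lemma Gr.exists_matrix_torusAct_eq (t : Fin n → ℂˣ) (W : Gr k n) :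
    ∃ g : Matrix (Fin k) (Fin k) ℂ,
      (W.torusAct t).matrix = g * W.matrix * Matrix.diagonal fun c => (t c : ℂ) := by
  choose w mem scale using fun i => mem_torusAct.mp ((W.torusAct t).matrix_mem i)
  obtain ⟨g, hg⟩ := exists_eq_mul_matrix_of_mem W (A := Matrix.of w) mem
  refine ⟨g, ?_⟩
  ext i c
  rw [← hg, Matrix.mul_diagonal, Matrix.of_apply, mul_comm]
  exact (congrFun (scale i) c).symm

lemma Gr.torusAct_eq_of_matrix_mul_diagonal_eq {W W' : Gr k n} {t : Fin n → ℂˣ}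
    {g : Matrix (Fin k) (Fin k) ℂ}
    (h : W'.matrix * Matrix.diagonal (fun c => (t c : ℂ)) = g * W.matrix) :
    W'.torusAct t = W := by
  obtain ⟨g', hg'⟩ := exists_matrix_torusAct_eq t W'
  exact eq_of_matrix_eq_mul (g := g' * g) (by rw [hg', Matrix.mul_assoc, h, Matrix.mul_assoc])

lemma exists_segreForm_torusAct_eq_smul (t : Fin (k * ℓ) → ℂˣ) (W : Gr k (k * ℓ)) :
    ∃ u : ℂ, segreForm (W.torusAct t).matrix = u • segreForm W.matrix := by
  obtain ⟨g, hg⟩ := Gr.exists_matrix_torusAct_eq t W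
  exact ⟨_, by rw [hg, segreForm_mul_diagonal, segreForm_mul_left, smul_smul]⟩

end TorusOrbits

section OrbitClosures

variable {k n ℓ : ℕ}

lemma exists_plucker_eq_colMinor (a b : Fin n) : ∃ F : MvPolynomial (Fin 2 ↪o Fin n) ℂ,
    F.IsHomogeneous 1 ∧ ∀ W : Gr 2 n, eval W.plucker F = colMinor W.matrix a b := by
  have of_lt {a b : Fin n} (hab : a < b) : ∃ I : Fin 2 ↪o Fin n, ∀ W : Gr 2 n,
      eval W.plucker (X I) = colMinor W.matrix a b :=
    ⟨OrderEmbedding.ofStrictMono ![a, b] (by simp [hab]), fun W => by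
      rw [eval_X, Gr.plucker, ← colMinor_eq_det]; rfl⟩
  rcases lt_trichotomy a b with hab | rfl | hab
  · obtain ⟨I, hI⟩ := of_lt hab
    exact ⟨X I, isHomogeneous_X _ _, hI⟩
  · exact ⟨0, isHomogeneous_zero _ _ _, fun W => by simp [colMinor]⟩
  · obtain ⟨I, hI⟩ := of_lt hab
    exact ⟨-X I, (isHomogeneous_X _ _).neg, fun W => by rw [map_neg, hI, ← colMinor_swap]⟩

lemma exists_plucker_eq_matchingProd (τ : Fin 2 × Fin ℓ ≃ Fin n) :
    ∃ F : MvPolynomial (Fin 2 ↪o Fin n) ℂ, F.IsHomogeneous ℓ ∧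
      ∀ W : Gr 2 n, eval W.plucker F = matchingProd (colMinor W.matrix) τ := by
  choose F hom eval_F using fun j => exists_plucker_eq_colMinor (τ (0, j)) (τ (1, j))
  refine ⟨∏ j, F j, ?_, fun W => ?_⟩
  · simpa using IsHomogeneous.prod Finset.univ F (fun _ => 1) fun j _ => hom j
  · rw [map_prod, matchingProd]
    exact Finset.prod_congr rfl fun j _ => eval_F j W

lemma Gr.IsUniform.pairwise_colMinor_ne_zero {W : Gr 2 n} (hW : W.IsUniform) :
    Pairwise fun a b => colMinor W.matrix a b ≠ 0 := by
  have of_lt {a b : Fin n} (hab : a < b) : colMinor W.matrix a b ≠ 0 := by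
    have := hW (OrderEmbedding.ofStrictMono ![a, b] (by simp [hab]))
    rwa [Gr.plucker, ← colMinor_eq_det] at this
  intro a b hab
  rcases hab.lt_or_gt with h | h
  · exact of_lt h
  · exact colMinor_swap W.matrix b a ▸ neg_ne_zero.mpr (of_lt h)

lemma segreMap_eq_iff_exists_smul {W W' : Gr k (k * ℓ)} (hW : W.IsUniform) (hW' : W'.IsUniform) :
    segreMap W hW = segreMap W' hW' ↔ ∃ u : ℂ, segreForm W.matrix = u • segreForm W'.matrix := by
  rw [segreMap, segreMap, Projectivization.mk_eq_mk_iff']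
  exact exists_congr fun u => ⟨fun h => congrArg Subtype.val h.symm, fun h => Subtype.ext h.symm⟩

lemma matchingProd_cross_eq_of_mem_orbitClosure {W W' : Gr 2 (2 * ℓ)} (h : W ∈ W'.orbitClosure)
    (τ τ' : Fin 2 × Fin ℓ ≃ Fin (2 * ℓ)) :
    matchingProd (colMinor W.matrix) τ * matchingProd (colMinor W'.matrix) τ' =
      matchingProd (colMinor W.matrix) τ' * matchingProd (colMinor W'.matrix) τ := by
  obtain ⟨F, hom_F, eval_F⟩ := exists_plucker_eq_matchingProd τ
  obtain ⟨F', hom_F', eval_F'⟩ := exists_plucker_eq_matchingProd τ'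
  let m (τ : Fin 2 × Fin ℓ ≃ Fin (2 * ℓ)) : ℂ := matchingProd (colMinor W'.matrix) τ
  have vanish := h ℓ (m τ' • F - m τ • F') (sub_mem
    (Submodule.smul_mem (homogeneousSubmodule _ _ ℓ) _ hom_F)
    (Submodule.smul_mem (homogeneousSubmodule _ _ ℓ) _ hom_F')) fun t => by
      obtain ⟨u, hu⟩ := exists_segreForm_torusAct_eq_smul t W'
      have proportional := (segreForm_eq_smul_iff _ _ u).mp hu
      rw [map_sub, smul_eval, smul_eval, eval_F, eval_F', proportional, proportional]
      ring
  rw [map_sub, smul_eval, smul_eval, eval_F, eval_F'] at vanish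
  linear_combination vanish

lemma segreMap_eq_of_mem_orbitClosure {W W' : Gr 2 (2 * ℓ)} (hW : W.IsUniform)
    (hW' : W'.IsUniform) (h : W ∈ W'.orbitClosure) : segreMap W hW = segreMap W' hW' := by
  have ne_zero := matchingProd_ne_zero hW'.pairwise_colMinor_ne_zero
    (finProdFinEquiv : Fin 2 × Fin ℓ ≃ Fin (2 * ℓ))
  obtain ⟨u, hu⟩ : ∃ u : ℂ, ∀ τ : Fin 2 × Fin ℓ ≃ Fin (2 * ℓ),
      matchingProd (colMinor W.matrix) τ = u * matchingProd (colMinor W'.matrix) τ := by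
    refine ⟨matchingProd (colMinor W.matrix) finProdFinEquiv /
      matchingProd (colMinor W'.matrix) finProdFinEquiv, fun τ => ?_⟩
    rw [div_mul_eq_mul_div, eq_div_iff ne_zero]
    exact matchingProd_cross_eq_of_mem_orbitClosure h τ finProdFinEquiv
  exact (segreMap_eq_iff_exists_smul hW hW').mpr ⟨u, (segreForm_eq_smul_iff _ _ u).mpr hu⟩

lemma exists_torusAct_eq_of_segreMap_eq {W W' : Gr 2 (2 * ℓ)} (hW : W.IsUniform)
    (hW' : W'.IsUniform) (h : segreMap W hW = segreMap W' hW') : ∃ t, W'.torusAct t = W := by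
  have : Nontrivial (Fin (2 * ℓ)) := Fin.nontrivial_iff_two_le.mpr <| by
    simpa [W.2] using Submodule.finrank_le W.1
  obtain ⟨u, hu⟩ := (segreMap_eq_iff_exists_smul hW hW').mp h
  have minors := hW.pairwise_colMinor_ne_zero
  have minors' := hW'.pairwise_colMinor_ne_zero
  obtain ⟨t, g, hg⟩ := exists_mul_diagonal_eq_mul_of_crossRatio_eq minors minors' fun _ _ _ _ =>
    crossRatio_eq_of_matchingProd_proportional finProdFinEquiv minors minors'
      ((segreForm_eq_smul_iff _ _ u).mp hu)
  exact ⟨t, Gr.torusAct_eq_of_matrix_mul_diagonal_eq hg⟩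

theorem segreMap_eq_iff_orbitClosure_eq {W W' : Gr 2 (2 * ℓ)} (hW : W.IsUniform)
    (hW' : W'.IsUniform) :
    segreMap W hW = segreMap W' hW' ↔ W.orbitClosure = W'.orbitClosure := by
  constructor
  · intro h
    obtain ⟨t, rfl⟩ := exists_torusAct_eq_of_segreMap_eq hW hW' h
    exact W'.orbitClosure_torusAct t
  · intro h
    exact segreMap_eq_of_mem_orbitClosure hW hW' (h ▸ W.mem_orbitClosure_self)

end OrbitClosures

end SegreCoeff

end

theorem corollary6p3 (ℓ : ℕ) (hℓ : 1 ≤ ℓ) :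
    (∀ (N : ℕ) (e : Module.Basis (Fin N) ℂ (SegreCoeff.grSections ℓ (2 * ℓ) 2)),
      Nonempty (SegreCoeff.projVariety (SegreCoeff.coeffVariety e) ≅
        SegreCoeff.gitQuotient (2 * ℓ))) ∧
    (∀ (W W' : SegreCoeff.Gr 2 (2 * ℓ)) (hW : W.IsUniform) (hW' : W'.IsUniform),
      SegreCoeff.segreMap W hW = SegreCoeff.segreMap W' hW' ↔
        W.orbitClosure = W'.orbitClosure) :=
  ⟨fun _ e => SegreCoeff.nonempty_coeffVariety_iso_gitQuotient e hℓ,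
    fun _ _ hW hW' => SegreCoeff.segreMap_eq_iff_orbitClosure_eq hW hW'⟩
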